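/- **Setting.** Consider the linear system $x_{t+1}=Ax_t+Bu_t+w_t$, $y_t=Cx_t+e_t$ with $u_t\in\mathbb R^{d_u}$, $y_t\in\mathbb R^{d_y}$, a fixed initial state $x_1$ and arbitrary (adversarial) sequences $w_t,e_t$. Let $\|\cdot\|_{\mathrm{op}}$ be the Euclidean operator norm, and let $K\in\mathbb R^{d_u\times d_y}$ be a known feedback matrix. Let $v^K_t=(y^K_t,u^K_t)$ be the trajectory under $u_t=Ky_t$, and let $G_K$ be the Markov operator $$G_K^{[0]}=\begin{bmatrix}0\\ I\end{bmatrix},\qquad G_K^{[i]}=\begin{bmatrix}C\\ KC\end{bmatrix}(A+BKC)^{i-1}B\quad(i\ge 1).$$ **Assumptions.** * Each loss $\ell_t:\mathbb R^{d_y+d_u}\to\mathbb R$ is differentiable and $\alpha$-strongly convex ($\alpha>0$), with $0\le \ell_t(v)\le L\max\{1,\|v\|^2\}$ and $\|\nabla\ell_t(v)\|\le L\max\{1,\|v\|\}$ for all $v$. * $\|v^K_t\|\le R_{\mathrm{nat}}$ for all $t\ge1$, where $R_{\mathrm{nat}}\ge 1$. * $\|G_K^{[n]}\|_{\mathrm{op}}\le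 c_K\rho_K^n$ for all $n\ge0$, where $c_K>0$ and $\rho_K\in(0,1)$. **Benchmark.** A linear dynamic controller $\pi=(A_\pi,B_\pi,C_\pi,D_\pi)$ with internal state of any finite dimension is $s_{t+1}=A_\pi s_t+B_\pi y_t$, $u_t=C_\pi s_t+D_\pi y_t$, $s_1=0$; let $(y^\pi_t,u^\pi_t)$ be its closed-loop trajectory. Put $G_{\pi,\mathrm{cl}}^{[0]}=[D_\pi\ \ 0]$ and, for $i\ge1$, $$G_{\pi,\mathrm{cl}}^{[i]}=\begin{bmatrix}(D_\pi-K)C & C_\pi\end{bmatrix}\begin{bmatrix}A+BD_\pi C& BC_\pi\\ B_\pi C&A_\pi\end{bmatrix}^{i-1}\begin{bmatrix}BD_\pi&-B\\ B_\pi&0\end{bmatrix}.$$ For $c_\star\ge 1$ and $\rho_\star\in(0,1)$ let $\Pi_{\mathrm{stab}}(c_\star,\rho_\star)=\{\pi:\ \|G_{\pi,\mathrm{cl}}^{[n]}\|_{\mathrm{op}}\le c_\star\rho_\star^n\ \ \forall n\ge0\}$. The control regret of an algorithm with trajectory $(y^{\mathsf{alg}}_t,u^{\mathsf{alg}}_t)$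 against a class $\Pi$ is $$\mathrm{ControlReg}_T(\mathsf{alg};\Pi)=\sum_{t=1}^T\ell_t(y^{\mathsf{alg}}_t,u^{\mathsf{alg}}_t)-\inf_{\pi\in\Pi}\sum_{t=1}^T\ell_t(y^\pi_t,u^\pi_t).$$ **Algorithm (DRC-ONS, known system).** It has parameters $h,m\in\mathbb N$ and $R_{\mathcal M},\eta,\lambda$. Its parameter set $\mathcal M$ consists of all $M=(M^{[0]},\dots,M^{[m-1]})$, $M^{[i]}\in\mathbb R^{d_u\times d_y}$, with $\sum_{i<m}\|M^{[i]}\|_{\mathrm{op}}\le R_{\mathcal M}$, identified with a subset of $\mathbb R^{m d_u d_y}$ by listing entries, $M\leftrightarrow z$. Start from any $z_1\in\mathcal M$ and $\Lambda_0=\lambda I$. In round $t$: 1. observe $y_t$ and compute $y^{\mathrm{nat}}_t=y_t-\sum_{i<t}G_{K,y}^{[t-i]}u^{\mathrm{ex}}_i$, where $G_{K,y}$ denotes the first $d_y$ rows of $G_K$; 2. play $u_t=Ky_t+u^{\mathrm{ex}}_t$ with $u^{\mathrm{ex}}_t=\sum_{i<m}M_t^{[i]}y^{\mathrm{nat}}_{t-i}$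 (terms with index before round $1$ are $0$); 3. receive $\ell_t$. Let $Y_s$ be the matrix of $M\mapsto\sum_{i<m}M^{[i]}y^{\mathrm{nat}}_{s-i}$ (with $Y_s=0$ for $s\le0$), let $H_t=\sum_{i=0}^hG_K^{[i]}Y_{t-i}$, and let $f_t(z)=\ell_t\big((y^{\mathrm{nat}}_t,Ky^{\mathrm{nat}}_t)+H_tz\big)$; 4. set $\Lambda_t=\Lambda_{t-1}+H_t^\top H_t$, $\tilde z_{t+1}=z_t-\eta\Lambda_t^{-1}\nabla f_t(z_t)$ and $z_{t+1}\in\arg\min_{z\in\mathcal M}\|\Lambda_t^{1/2}(z-\tilde z_{t+1})\|$. **Theorem.** There is a universal constant $\mathfrak C>0$ such that, in this setting and for every horizon $T$, DRC-ONS run with $$h=\Big\lceil\tfrac{\log T}{1-\rho_K}\Big\rceil,\quad m=\Big\lceil\tfrac{\log T}{1-\rho_\star}\Big\rceil,\quad R_{\mathcal M}=(1+\|K\|_{\mathrm{op}})\tfrac{c_\star}{1-\rho_\star},\quad \eta=\tfrac1\alpha,\quad \lambda=6hR_{\mathrm{nat}}^2\tfrac{c_K^2}{(1-\rho_K)^2}$$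 satisfies $$\mathrm{ControlReg}_T(\mathsf{alg};\Pi_{\mathrm{stab}}(c_\star,\rho_\star))\le \mathfrak C\cdot\frac{c_K^3c_\star^2(1+\|K\|_{\mathrm{op}})^3}{(1-\rho_K)^5(1-\rho_\star)^3}\cdot d_ud_yR_{\mathrm{nat}}^2\cdot\frac{L^2}{\alpha}\log^4(1+T).$$ -/

import Mathlib

open Matrix

noncomputable section

namespace DrcOns

/-! Time is indexed by `t = 0, 1, 2, …`; index `t` stands for round `t + 1` when
rounds are counted from `1`, and the `T` rounds are the elements of `Finset.range T`. -/

/-- Vectors of states, outputs and inputs (no norm on this type is used). -/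
abbrev Vec (n : ℕ) : Type := Fin n → ℝ

/-- The space `ℝ^{d_y + d_u}` of pairs `v = (y, u)`, with its Euclidean norm. -/
abbrev Sig (dy du : ℕ) : Type := EuclideanSpace ℝ (Fin dy ⊕ Fin du)

/-- The pair `v = (y, u)`. -/
def pair {dy du : ℕ} (y : Vec dy) (u : Vec du) : Sig dy du :=
  WithLp.toLp 2 (Sum.elim y u)

/-- Euclidean operator norm (largest singular value) of a rectangular matrix. -/
def opNorm {p q : Type*} [Fintype p] [Fintype q] [DecidableEq q] (M : Matrix p q ℝ) : ℝ :=
  ‖LinearMap.toContinuousLinearMap (Matrix.toEuclideanLin M)‖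

/-- A partially observed linear system
`x_{t+1} = A x_t + B u_t + w_t`, `y_t = C x_t + e_t`, with its initial state and its
(adversarial) disturbance sequences. -/
structure Plant (dx du dy : ℕ) where
  A : Matrix (Fin dx) (Fin dx) ℝ
  B : Matrix (Fin dx) (Fin du) ℝ
  C : Matrix (Fin dy) (Fin dx) ℝ
  x₁ : Vec dx
  w : ℕ → Vec dx
  e : ℕ → Vec dy

/-- A linear dynamic controller `s_{t+1} = A s_t + B y_t`, `u_t = C s_t + D y_t`, with an
internal state of arbitrary finite dimension. -/
structure LDC (du dy : ℕ) where
  dim : ℕ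
  A : Matrix (Fin dim) (Fin dim) ℝ
  B : Matrix (Fin dim) (Fin dy) ℝ
  C : Matrix (Fin du) (Fin dim) ℝ
  D : Matrix (Fin du) (Fin dy) ℝ

/-- The static feedback law `u_t = K y_t` as a linear dynamic controller. -/
def LDC.static {du dy : ℕ} (K : Matrix (Fin du) (Fin dy) ℝ) : LDC du dy where
  dim := 0
  A := 0
  B := 0
  C := 0
  D := K

variable {dx du dy : ℕ}

/-- Closed-loop states `(x_t^π, s_t^π)`; the controller's internal state starts at `0`. -/
def ldcState (P : Plant dx du dy) (π : LDC du dy) : ℕ → Vec dx × Vec π.dim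
  | 0 => (P.x₁, 0)
  | t + 1 =>
    let x := (ldcState P π t).1
    let s := (ldcState P π t).2
    let y := P.C *ᵥ x + P.e t
    let u := π.C *ᵥ s + π.D *ᵥ y
    (P.A *ᵥ x + P.B *ᵥ u + P.w t, π.A *ᵥ s + π.B *ᵥ y)

/-- Closed-loop iterates `(y_t^π, u_t^π)`. -/
def ldcIterate (P : Plant dx du dy) (π : LDC du dy) (t : ℕ) : Sig dy du :=
  let x := (ldcState P π t).1
  let s := (ldcState P π t).2
  let y := P.C *ᵥ x + P.e t
  pair y (π.C *ᵥ s + π.D *ᵥ y)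

/-- Nature's iterates `v_t^K = (y_t^K, u_t^K)`: the trajectory under `u_t = K y_t`. -/
def natIterate (P : Plant dx du dy) (K : Matrix (Fin du) (Fin dy) ℝ) (t : ℕ) : Sig dy du :=
  ldcIterate P (LDC.static K) t

/-- The nominal Markov operator `G_K`, from exogenous inputs `u^ex` (where `u = K y + u^ex`) to
`(y, u)`: `G_K^{[0]} = [0; I]` and `G_K^{[i]} = [C; K C] (A + B K C)^{i-1} B` for `i ≥ 1`. -/
def markovK (P : Plant dx du dy) (K : Matrix (Fin du) (Fin dy) ℝ) :
    ℕ → Matrix (Fin dy ⊕ Fin du) (Fin du) ℝ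
  | 0 => Matrix.fromRows 0 1
  | i + 1 => Matrix.fromRows P.C (K * P.C) * (P.A + P.B * K * P.C) ^ i * P.B

/-- The closed-loop Markov operator `G_{π,cl}` of a linear dynamic controller `π`, relative to
the static stabilizing feedback `K`. -/
def markovCl (P : Plant dx du dy) (K : Matrix (Fin du) (Fin dy) ℝ) (π : LDC du dy) :
    ℕ → Matrix (Fin du) (Fin dy ⊕ Fin du) ℝ
  | 0 => Matrix.fromCols π.D 0
  | i + 1 =>
    Matrix.fromCols ((π.D - K) * P.C) π.C *
      Matrix.fromBlocks (P.A + P.B * π.D * P.C) (P.B * π.C) (π.B * P.C) π.A ^ i *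
      Matrix.fromBlocks (P.B * π.D) (-P.B) π.B 0

/-- The comparator class `Π_stab(c, ρ)`. -/
def stabClass (P : Plant dx du dy) (K : Matrix (Fin du) (Fin dy) ℝ) (c ρ : ℝ) :
    Set (LDC du dy) :=
  {π | ∀ n : ℕ, opNorm (markovCl P K π n) ≤ c * ρ ^ n}

/-- Regular losses: differentiable, `α`-strongly convex and `L`-subquadratic. -/
structure LossRegular (L α : ℝ) (ℓ : Sig dy du → ℝ) : Prop where
  differentiable : Differentiable ℝ ℓ
  strongConvex : StrongConvexOn Set.univ α ℓ
  nonneg : ∀ v, 0 ≤ ℓ v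
  le : ∀ v, ℓ v ≤ L * max 1 (‖v‖ ^ 2)
  gradient_le : ∀ v, ‖gradient ℓ v‖ ≤ L * max 1 ‖v‖

/-! ### The algorithm -/

/-- Disturbance-response parameters `M = (M^{[0]}, …, M^{[m-1]})`, flattened to a Euclidean
vector `z` with coordinates `z (i, a, b) = M^{[i]}_{a b}`. -/
abbrev Param (m du dy : ℕ) : Type := EuclideanSpace ℝ (Fin m × Fin du × Fin dy)

/-- The matrix `M^{[i]}` encoded by `z`. -/
def Param.mat {m : ℕ} (z : Param m du dy) (i : Fin m) : Matrix (Fin du) (Fin dy) ℝ :=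
  Matrix.of fun a b => z (i, a, b)

/-- The constraint set `∑_{i < m} ‖M^{[i]}‖_op ≤ R`. -/
def drcSet (m du dy : ℕ) (R : ℝ) : Set (Param m du dy) :=
  {z | ∑ i : Fin m, opNorm (z.mat i) ≤ R}

/-- The matrix `Y_t` of the linear map `z ↦ ∑_{i < m} M^{[i]} ω_{t-i}`
(with `ω_s = 0` before the first round). -/
def embedY (m du : ℕ) (ω : ℕ → Vec dy) (t : ℕ) :
    Matrix (Fin du) (Fin m × Fin du × Fin dy) ℝ :=
  Matrix.of fun a j => if a = j.2.1 ∧ (j.1 : ℕ) ≤ t then ω (t - j.1) j.2.2 else 0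

/-- `H_t = ∑_{i=0}^h G^{[i]} Y_{t-i}` (with `Y_s = 0` before the first round). -/
def featH (h m : ℕ) (G : ℕ → Matrix (Fin dy ⊕ Fin du) (Fin du) ℝ) (ω : ℕ → Vec dy) (t : ℕ) :
    Matrix (Fin dy ⊕ Fin du) (Fin m × Fin du × Fin dy) ℝ :=
  ∑ i ∈ Finset.range (h + 1), if i ≤ t then G i * embedY m du ω (t - i) else 0

open Classical in
/-- A minimizer over `S` of `‖Λ^{1/2} (z - p)‖² = (z - p)ᵀ Λ (z - p)`. -/
def weightedProj {ι : Type*} [Fintype ι] (S : Set (EuclideanSpace ℝ ι)) (Λ : Matrix ι ι ℝ)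
    (p : EuclideanSpace ℝ ι) : EuclideanSpace ℝ ι :=
  if hz : ∃ z ∈ S, IsMinOn (fun q : EuclideanSpace ℝ ι => (q - p).ofLp ⬝ᵥ (Λ *ᵥ (q - p).ofLp)) S z
  then hz.choose else p

/-- One projected semi-Newton step: `z ↦ argmin_{q ∈ S} ‖Λ^{1/2} (q - (z - η Λ⁻¹ ∇f(z)))‖`. -/
def semiOnsStep {ι : Type*} [Fintype ι] [DecidableEq ι] (S : Set (EuclideanSpace ℝ ι)) (η : ℝ)
    (Λ : Matrix ι ι ℝ) (f : EuclideanSpace ℝ ι → ℝ) (z : EuclideanSpace ℝ ι) :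
    EuclideanSpace ℝ ι :=
  weightedProj S Λ (z - η • WithLp.toLp 2 (Λ⁻¹ *ᵥ (gradient f z).ofLp))

/-- Tuning parameters: memory `h`, length `m`, radius `R`, step size `η`, regularization `lam`. -/
structure Config where
  h : ℕ
  m : ℕ
  R : ℝ
  η : ℝ
  lam : ℝ

/-- What the algorithm remembers at the start of round `t`: the current parameter `z_t`, the
preconditioner `Λ_{t-1}`, and the recorded `y^nat_s`, `u^ex_s` for `s < t`. -/
structure Memory (m du dy : ℕ) where
  z : Param m du dy
  Λ : Matrix (Fin m × Fin du × Fin dy) (Fin m × Fin du × Fin dy) ℝ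
  ynat : ℕ → Vec dy
  uex : ℕ → Vec du

/-- Initial memory: `Λ_0 = lam • I` and initial parameter `z₁`. -/
def Memory.init (cfg : Config) (z₁ : Param cfg.m du dy) : Memory cfg.m du dy where
  z := z₁
  Λ := cfg.lam • (1 : Matrix _ _ ℝ)
  ynat := 0
  uex := 0

/-- After observing `y_t`, append `y^nat_t = y_t - ∑_{i<t} G_y^{[t-i]} u^ex_i`, where `G_y` is the
block of the first `d_y` rows of `G`, to the recorded sequence. -/
def Memory.recover {m : ℕ} (G : ℕ → Matrix (Fin dy ⊕ Fin du) (Fin du) ℝ) (S : Memory m du dy)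
    (t : ℕ) (y : Vec dy) : ℕ → Vec dy :=
  Function.update S.ynat t
    (y - ∑ i ∈ Finset.range t, Matrix.toRows₁ (G (t - i)) *ᵥ S.uex i)

/-- The exogenous input `u^ex_t = ∑_{i < m} M_t^{[i]} y^nat_{t-i}`. -/
def Memory.exInput {m : ℕ} (G : ℕ → Matrix (Fin dy ⊕ Fin du) (Fin du) ℝ) (S : Memory m du dy)
    (t : ℕ) (y : Vec dy) : Vec du :=
  embedY m du (S.recover G t y) t *ᵥ S.z.ofLp

/-- The control `u_t = K y_t + u^ex_t` played by the algorithm. -/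
def Memory.control {m : ℕ} (G : ℕ → Matrix (Fin dy ⊕ Fin du) (Fin du) ℝ)
    (K : Matrix (Fin du) (Fin dy) ℝ) (S : Memory m du dy) (t : ℕ) (y : Vec dy) : Vec du :=
  K *ᵥ y + S.exInput G t y

/-- Update after the loss `ℓ` of round `t` is revealed: with
`f_t(z) = ℓ_t((y^nat_t, K y^nat_t) + H_t z)`, put `Λ_t = Λ_{t-1} + H_tᵀ H_t` and take one
projected semi-Newton step. -/
def Memory.update (cfg : Config) (G : ℕ → Matrix (Fin dy ⊕ Fin du) (Fin du) ℝ)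
    (K : Matrix (Fin du) (Fin dy) ℝ) (S : Memory cfg.m du dy) (t : ℕ) (y : Vec dy)
    (ℓ : Sig dy du → ℝ) : Memory cfg.m du dy :=
  let ω := S.recover G t y
  let H := featH cfg.h cfg.m G ω t
  let f : Param cfg.m du dy → ℝ := fun z =>
    ℓ (pair (ω t) (K *ᵥ ω t) + WithLp.toLp 2 (H *ᵥ z.ofLp))
  let Λ := S.Λ + Hᵀ * H
  { z := semiOnsStep (drcSet cfg.m du dy cfg.R) cfg.η Λ f S.z
    Λ := Λ
    ynat := ω
    uex := Function.update S.uex t (S.exInput G t y) }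

/-- The plant state and the algorithm's memory at the start of each round, when DRC-ONS with
known Markov operator `G_K` controls the plant `P` against the losses `ℓ`. -/
def algState (P : Plant dx du dy) (K : Matrix (Fin du) (Fin dy) ℝ) (ℓ : ℕ → Sig dy du → ℝ)
    (cfg : Config) (z₁ : Param cfg.m du dy) : ℕ → Vec dx × Memory cfg.m du dy
  | 0 => (P.x₁, Memory.init cfg z₁)
  | t + 1 =>
    let x := (algState P K ℓ cfg z₁ t).1
    let S := (algState P K ℓ cfg z₁ t).2
    let y := P.C *ᵥ x + P.e t
    (P.A *ᵥ x + P.B *ᵥ S.control (markovK P K) K t y + P.w t,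
      S.update cfg (markovK P K) K t y (ℓ t))

/-- The iterates `(y_t^alg, u_t^alg)` of DRC-ONS. -/
def algIterate (P : Plant dx du dy) (K : Matrix (Fin du) (Fin dy) ℝ) (ℓ : ℕ → Sig dy du → ℝ)
    (cfg : Config) (z₁ : Param cfg.m du dy) (t : ℕ) : Sig dy du :=
  let x := (algState P K ℓ cfg z₁ t).1
  let S := (algState P K ℓ cfg z₁ t).2
  let y := P.C *ᵥ x + P.e t
  pair y (S.control (markovK P K) K t y)

/-- `∑_t ℓ_t(y_t, u_t) - inf_{π ∈ Π} ∑_t ℓ_t(y_t^π, u_t^π)` over `T` rounds for the iterates `v`,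
in the extended reals (so that the infimum over an empty class is `⊤`). -/
def controlRegret (P : Plant dx du dy) (ℓ : ℕ → Sig dy du → ℝ) (T : ℕ) (v : ℕ → Sig dy du)
    (cls : Set (LDC du dy)) : EReal :=
  ((∑ t ∈ Finset.range T, ℓ t (v t) : ℝ) : EReal) -
    ⨅ π ∈ cls, ((∑ t ∈ Finset.range T, ℓ t (ldcIterate P π t) : ℝ) : EReal)

/-- The prescribed parameters: `h = ⌈log T / (1 - ρ_K)⌉`, `m = ⌈log T / (1 - ρ⋆)⌉`,
`R = (1 + ‖K‖_op) c⋆ / (1 - ρ⋆)`, `η = 1/α`, `lam = 6 h R_nat² c_K² / (1 - ρ_K)²`. -/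
def explicitConfig (T : ℕ) (K : Matrix (Fin du) (Fin dy) ℝ) (α Rnat cK ρK cs ρs : ℝ) : Config where
  h := ⌈Real.log T / (1 - ρK)⌉₊
  m := ⌈Real.log T / (1 - ρs)⌉₊
  R := (1 + opNorm K) * (cs / (1 - ρs))
  η := 1 / α
  lam := 6 * (⌈Real.log T / (1 - ρK)⌉₊ : ℝ) * Rnat ^ 2 * (cK / (1 - ρK)) ^ 2

end DrcOns

end

/-!
With `u_t = K y_t + u_t^ex`, every trajectory is nature's trajectory plus the convolution of `G_K`
with the exogenous inputs. For a controller `π`, the exogenous inputs are in turn the convolution of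
`G_{π,cl} [I; K]` (with `D_π - K` at index `0`) with `y^nat`, so truncating the coefficients at `m`
gives a point of the constraint set whose losses are within `O(ρ⋆^m)` of those of `π`; the
algorithm's own loss `ℓ_t(v_t)` differs from `f_t(z_t)` by the tail of `G_K` beyond `h` and by the
drift of `z`.

The losses `f_t` are strongly convex only along `H_t`, which is enough for online Newton: with
`Λ_t ⪰ H_tᵀ H_t` the quadratic terms telescope, and the remaining error is the sum of the leverages
`tr (H_t Λ_t⁻¹ H_tᵀ)`, at most `dim · log (1 + T)` by the determinant bound. The drift is paid by
the same sum: since `Λ` is increasing, the Newton step satisfies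
`‖H_s (z_{t+1} - z_t)‖ ≤ (γ / 2α) (lev_s + lev_t)` for `s ≤ t`. The memory terms involve `Y_s`
rather than `H_s`, and `[-K, I] G_K^{[i]} = 0` for `i ≥ 1` recovers `Y_s = [-K, I] H_s` at the cost
of a factor `1 + ‖K‖_op`.
-/

noncomputable section

namespace DrcOns

/-! ### Euclidean and operator norms -/

section Norms

variable {ι κ μ : Type*} [Fintype ι] [Fintype κ] [Fintype μ]

/-- The Euclidean norm of a coordinate vector; the norm instance on `ι → ℝ` is the supremum
norm. -/
def l2norm (x : ι → ℝ) : ℝ := ‖WithLp.toLp 2 x‖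

lemma l2norm_nonneg (x : ι → ℝ) : 0 ≤ l2norm x := norm_nonneg _

@[simp] lemma l2norm_zero : l2norm (0 : ι → ℝ) = 0 := by simp [l2norm]

lemma l2norm_add_le (x y : ι → ℝ) : l2norm (x + y) ≤ l2norm x + l2norm y :=
  norm_add_le (WithLp.toLp 2 x) (WithLp.toLp 2 y)

lemma l2norm_sub_le (x y : ι → ℝ) : l2norm (x - y) ≤ l2norm x + l2norm y :=
  norm_sub_le (WithLp.toLp 2 x) (WithLp.toLp 2 y)

lemma l2norm_sub_rev (x y : ι → ℝ) : l2norm (x - y) = l2norm (y - x) :=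
  norm_sub_rev (WithLp.toLp 2 x) (WithLp.toLp 2 y)

lemma l2norm_sum_le {σ : Type*} (s : Finset σ) (f : σ → ι → ℝ) :
    l2norm (∑ i ∈ s, f i) ≤ ∑ i ∈ s, l2norm (f i) := by
  simpa only [l2norm, WithLp.toLp_sum] using norm_sum_le s fun i => WithLp.toLp 2 (f i)

lemma l2norm_sq (x : ι → ℝ) : l2norm x ^ 2 = ∑ i, x i ^ 2 := by
  simp [l2norm, EuclideanSpace.norm_sq_eq]

lemma l2norm_sq_eq_dotProduct (x : ι → ℝ) : l2norm x ^ 2 = x ⬝ᵥ x := by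
  rw [l2norm_sq]
  simp only [dotProduct, sq]

lemma inner_eq_dotProduct (x y : EuclideanSpace ℝ ι) : inner ℝ x y = x.ofLp ⬝ᵥ y.ofLp := by
  simp [EuclideanSpace.inner_eq_star_dotProduct, dotProduct_comm]

lemma abs_le_l2norm (x : ι → ℝ) (i : ι) : |x i| ≤ l2norm x :=
  PiLp.norm_apply_le (WithLp.toLp 2 x) i

lemma l2norm_sumElim_sq (x : ι → ℝ) (y : κ → ℝ) :
    l2norm (Sum.elim x y) ^ 2 = l2norm x ^ 2 + l2norm y ^ 2 := by
  simp [l2norm_sq]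

lemma l2norm_sumElim_zero (x : ι → ℝ) : l2norm (Sum.elim x (0 : κ → ℝ)) = l2norm x := by
  rw [← sq_eq_sq₀ (l2norm_nonneg _) (l2norm_nonneg _), l2norm_sumElim_sq]
  simp

lemma l2norm_comp_inl_le (v : ι ⊕ κ → ℝ) : l2norm (v ∘ Sum.inl) ≤ l2norm v := by
  rw [← sq_le_sq₀ (l2norm_nonneg _) (l2norm_nonneg _)]
  conv_rhs => rw [← Sum.elim_comp_inl_inr v, l2norm_sumElim_sq]
  exact le_add_of_nonneg_right (sq_nonneg _)

lemma l2norm_comp_inr_le (v : ι ⊕ κ → ℝ) : l2norm (v ∘ Sum.inr) ≤ l2norm v := by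
  rw [← sq_le_sq₀ (l2norm_nonneg _) (l2norm_nonneg _)]
  conv_rhs => rw [← Sum.elim_comp_inl_inr v, l2norm_sumElim_sq]
  exact le_add_of_nonneg_left (sq_nonneg _)

lemma l2norm_sumElim_le (x : ι → ℝ) (y : κ → ℝ) :
    l2norm (Sum.elim x y) ≤ l2norm x + l2norm y := by
  have hx := l2norm_nonneg x
  have hy := l2norm_nonneg y
  rw [← sq_le_sq₀ (l2norm_nonneg _) (by positivity), l2norm_sumElim_sq]
  nlinarith

section OpNorm

variable [DecidableEq κ]

open scoped Matrix.Norms.L2Operator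

lemma opNorm_eq_norm (M : Matrix ι κ ℝ) : opNorm M = ‖M‖ := rfl

lemma opNorm_nonneg (M : Matrix ι κ ℝ) : 0 ≤ opNorm M := norm_nonneg _

lemma opNorm_sub_le (M N : Matrix ι κ ℝ) : opNorm (M - N) ≤ opNorm M + opNorm N := by
  simpa only [opNorm_eq_norm] using norm_sub_le M N

lemma opNorm_mul_le [DecidableEq μ] (M : Matrix ι κ ℝ) (N : Matrix κ μ ℝ) :
    opNorm (M * N) ≤ opNorm M * opNorm N :=
  l2_opNorm_mul M N

lemma convexOn_opNorm : ConvexOn ℝ Set.univ (opNorm : Matrix ι κ ℝ → ℝ) :=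
  convexOn_norm convex_univ

lemma continuous_opNorm : Continuous (opNorm : Matrix ι κ ℝ → ℝ) := by
  simpa only [funext opNorm_eq_norm] using (continuous_norm (E := Matrix ι κ ℝ))

lemma l2norm_mulVec_le (M : Matrix ι κ ℝ) (x : κ → ℝ) :
    l2norm (M *ᵥ x) ≤ opNorm M * l2norm x :=
  l2_opNorm_mulVec M (WithLp.toLp 2 x)

lemma opNorm_le_of_forall_l2norm_mulVec_le {M : Matrix ι κ ℝ} {c : ℝ} (hc : 0 ≤ c)
    (h : ∀ x, l2norm (M *ᵥ x) ≤ c * l2norm x) : opNorm M ≤ c :=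
  ContinuousLinearMap.opNorm_le_bound _ hc fun x => h x.ofLp

lemma abs_entry_le_opNorm (M : Matrix ι κ ℝ) (i : ι) (j : κ) : |M i j| ≤ opNorm M := by
  simpa [l2norm] using (abs_le_l2norm _ i).trans (l2norm_mulVec_le M (Pi.single j 1))

lemma opNorm_fromRows_one_le (K : Matrix ι κ ℝ) :
    opNorm (fromRows (1 : Matrix κ κ ℝ) K) ≤ 1 + opNorm K := by
  refine opNorm_le_of_forall_l2norm_mulVec_le (add_nonneg zero_le_one (opNorm_nonneg K))
    fun x => ?_
  rw [fromRows_mulVec, one_mulVec, add_mul, one_mul]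
  exact (l2norm_sumElim_le _ _).trans (add_le_add_right (l2norm_mulVec_le K x) _)

lemma opNorm_fromCols_neg_one_le [DecidableEq ι] (K : Matrix ι κ ℝ) :
    opNorm (fromCols (-K) (1 : Matrix ι ι ℝ)) ≤ 1 + opNorm K := by
  refine opNorm_le_of_forall_l2norm_mulVec_le (add_nonneg zero_le_one (opNorm_nonneg K))
    fun v => ?_
  calc l2norm (fromCols (-K) 1 *ᵥ v) = l2norm (v ∘ Sum.inr - K *ᵥ (v ∘ Sum.inl)) := by
        rw [fromCols_mulVec, neg_mulVec, one_mulVec, neg_add_eq_sub]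
    _ ≤ l2norm (v ∘ Sum.inr) + opNorm K * l2norm (v ∘ Sum.inl) :=
        (l2norm_sub_le _ _).trans (add_le_add_right (l2norm_mulVec_le K _) _)
    _ ≤ l2norm v + opNorm K * l2norm v :=
        add_le_add (l2norm_comp_inr_le v)
          (mul_le_mul_of_nonneg_left (l2norm_comp_inl_le v) (opNorm_nonneg K))
    _ = (1 + opNorm K) * l2norm v := by ring

end OpNorm

end Norms

/-! ### Gradients and strong convexity -/

section Gradient

variable {E F : Type*} [NormedAddCommGroup E] [InnerProductSpace ℝ E]
  [NormedAddCommGroup F] [InnerProductSpace ℝ F] [CompleteSpace F]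

lemma hasGradientAt_comp_const_add_clm [CompleteSpace E] {f : F → ℝ} {g v : F} (A : E →L[ℝ] F)
    {x : E} (hf : HasGradientAt f g (v + A x)) :
    HasGradientAt (fun y => f (v + A y)) (ContinuousLinearMap.adjoint A g) x := by
  rw [hasGradientAt_iff_hasFDerivAt] at hf ⊢
  refine (hf.comp x (A.hasFDerivAt.const_add v)).congr_fderiv ?_
  ext y
  simp [ContinuousLinearMap.adjoint_inner_left]

lemma strongConvexOn_add_inner_gradient_le {s : Set F} {m : ℝ} {f : F → ℝ}
    (hf : StrongConvexOn s m f) {x y g : F} (hx : x ∈ s) (hy : y ∈ s) (hg : HasGradientAt f g x) :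
    f x + inner ℝ g (y - x) + m / 2 * ‖y - x‖ ^ 2 ≤ f y := by
  have line_deriv : HasDerivAt (AffineMap.lineMap x y : ℝ → F) (y - x) 0 :=
    AffineMap.hasDerivAt_lineMap
  have restricted_deriv : HasDerivAt
      ((fun z => f z - m / 2 * ‖z‖ ^ 2) ∘ (AffineMap.lineMap x y : ℝ → F))
      (inner ℝ g (y - x) - m / 2 * (2 * inner ℝ x (y - x))) 0 := by
    rw [← AffineMap.lineMap_apply_zero (k := ℝ) x y] at hg
    have := (hg.hasFDerivAt.comp_hasDerivAt (0 : ℝ) line_deriv).sub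
      (line_deriv.norm_sq.const_mul (m / 2))
    simpa [Function.comp_def, Pi.sub_def] using this
  have slope_bound := ((strongConvexOn_iff_convex.1 hf).comp_affineMap
    (AffineMap.lineMap x y)).le_slope_of_hasDerivAt (x := 0) (y := 1) (by simpa) (by simpa)
      zero_lt_one restricted_deriv
  simp only [slope_def_field, Function.comp_apply, AffineMap.lineMap_apply_one,
    AffineMap.lineMap_apply_zero, sub_zero, div_one] at slope_bound
  rw [norm_sub_sq_real, real_inner_comm]
  simp only [inner_sub_right, inner_sub_left, real_inner_self_eq_norm_sq, real_inner_comm] at *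
  linarith

end Gradient

section LossRegular

variable {dy du : ℕ} {L α : ℝ} {ℓ : Sig dy du → ℝ}

lemma LossRegular.add_inner_gradient_le (hℓ : LossRegular L α ℓ) (v w : Sig dy du) :
    ℓ v + inner ℝ (gradient ℓ v) (w - v) + α / 2 * ‖w - v‖ ^ 2 ≤ ℓ w :=
  strongConvexOn_add_inner_gradient_le hℓ.strongConvex (Set.mem_univ v) (Set.mem_univ w)
    (hℓ.differentiable v).hasGradientAt

lemma LossRegular.const_nonneg (hℓ : LossRegular L α ℓ) : 0 ≤ L := by
  simpa using (hℓ.nonneg 0).trans (hℓ.le 0)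

lemma LossRegular.sub_le (hℓ : LossRegular L α ℓ) (hα : 0 ≤ α) {r : ℝ} (hr : 1 ≤ r)
    {v w : Sig dy du} (hv : ‖v‖ ≤ r) : ℓ v - ℓ w ≤ L * r * ‖v - w‖ := by
  have gradient_bound : ‖gradient ℓ v‖ ≤ L * r :=
    (hℓ.gradient_le v).trans (mul_le_mul_of_nonneg_left (max_le hr hv) hℓ.const_nonneg)
  have first_order : ℓ v - ℓ w ≤ inner ℝ (gradient ℓ v) (v - w) := by
    have := hℓ.add_inner_gradient_le v w
    rw [← neg_sub v w, inner_neg_right] at this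
    linarith [mul_nonneg (div_nonneg hα zero_le_two) (sq_nonneg ‖-(v - w)‖)]
  calc ℓ v - ℓ w ≤ ‖gradient ℓ v‖ * ‖v - w‖ := first_order.trans (real_inner_le_norm _ _)
    _ ≤ L * r * ‖v - w‖ := mul_le_mul_of_nonneg_right gradient_bound (norm_nonneg _)

lemma LossRegular.convexity_le_const (hℓ : LossRegular L α ℓ) {v : Sig dy du} (hv : ‖v‖ = 1) :
    α ≤ L := by
  have gradient_bound {x : Sig dy du} (hx : ‖x‖ = 1) (w : Sig dy du) :
      -(L * ‖w‖) ≤ inner ℝ (gradient ℓ x) w := by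
    have := hℓ.gradient_le x
    rw [hx, max_self, mul_one] at this
    exact (neg_le_neg (mul_le_mul_of_nonneg_right this (norm_nonneg w))).trans
      (abs_le.1 (abs_real_inner_le_norm _ _)).1
  have dist_neg_self : ‖v - -v‖ = 2 := by rw [sub_neg_eq_add, ← two_smul ℝ v]; simp [norm_smul, hv]
  have dist_self_neg : ‖-v - v‖ = 2 := by rw [← dist_neg_self, norm_sub_rev]
  have at_v := hℓ.add_inner_gradient_le v (-v)
  have at_neg_v := hℓ.add_inner_gradient_le (-v) v
  have bound_v := gradient_bound hv (-v - v)
  have bound_neg_v := gradient_bound (x := -v) (by rwa [norm_neg]) (v - -v)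
  rw [dist_self_neg] at at_v bound_v
  rw [dist_neg_self] at at_neg_v bound_neg_v
  linarith

end LossRegular

section MatrixGradient

variable {ι κ : Type*} [Fintype ι] [Fintype κ]

lemma gradient_comp_const_add_mulVec {f : EuclideanSpace ℝ κ → ℝ} {v : EuclideanSpace ℝ κ}
    {H : Matrix κ ι ℝ} {z : EuclideanSpace ℝ ι}
    (hf : DifferentiableAt ℝ f (v + WithLp.toLp 2 (H *ᵥ z.ofLp))) :
    gradient (fun z : EuclideanSpace ℝ ι => f (v + WithLp.toLp 2 (H *ᵥ z.ofLp))) z =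
      WithLp.toLp 2 (Hᵀ *ᵥ (gradient f (v + WithLp.toLp 2 (H *ᵥ z.ofLp))).ofLp) := by
  classical
  refine (hasGradientAt_comp_const_add_clm
    (LinearMap.toContinuousLinearMap (toEuclideanLin H)) hf.hasGradientAt).gradient.trans ?_
  rw [← LinearMap.adjoint_toContinuousLinearMap, ← toEuclideanLin_conjTranspose_eq_adjoint]
  rfl

end MatrixGradient

/-! ### Leverage scores and determinants -/

section Leverage

variable {ι κ : Type*} [Fintype κ]

lemma posDef_add_transpose_mul_self [Finite ι] {Λ : Matrix ι ι ℝ} (hΛ : Λ.PosDef)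
    (H : Matrix κ ι ℝ) :
    (Λ + Hᵀ * H).PosDef :=
  hΛ.add_posSemidef <| by
    simpa only [conjTranspose_eq_transpose_of_trivial] using posSemidef_conjTranspose_mul_self H

variable [Fintype ι]

lemma l2norm_mulVec_sq_le_trace (M : Matrix κ ι ℝ) (x : ι → ℝ) :
    l2norm (M *ᵥ x) ^ 2 ≤ (M * Mᵀ).trace * l2norm x ^ 2 := by
  rw [l2norm_sq, trace, Finset.sum_mul]
  refine Finset.sum_le_sum fun i _ => ?_
  calc (M *ᵥ x) i ^ 2 ≤ (∑ j, M i j ^ 2) * ∑ j, x j ^ 2 :=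
        Finset.sum_mul_sq_le_sq_mul_sq _ _ _
    _ = (M * Mᵀ).diag i * l2norm x ^ 2 := by
        rw [l2norm_sq]
        simp only [diag_apply, mul_apply, transpose_apply, sq]

open scoped MatrixOrder in
lemma exists_eq_transpose_mul_self {Λ : Matrix ι ι ℝ} (hΛ : Λ.PosSemidef) :
    ∃ E : Matrix ι ι ℝ, Λ = Eᵀ * E := by
  classical
  simpa only [star_eq_conjTranspose, conjTranspose_eq_transpose_of_trivial] using
    CStarAlgebra.nonneg_iff_eq_star_mul_self.1 hΛ.nonneg

variable [DecidableEq ι]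

lemma exists_whitening {Λ : Matrix ι ι ℝ} (hΛ : Λ.PosDef) :
    ∃ E F : Matrix ι ι ℝ, F * E = 1 ∧ Λ = Eᵀ * E ∧ Λ⁻¹ = F * Fᵀ := by
  obtain ⟨E, rfl⟩ := exists_eq_transpose_mul_self hΛ.posSemidef
  have det_ne_zero : E.det ≠ 0 := right_ne_zero_of_mul (det_mul Eᵀ E ▸ hΛ.det_pos.ne')
  exact ⟨E, E⁻¹, nonsing_inv_mul E det_ne_zero.isUnit, rfl,
    by rw [Matrix.mul_inv_rev, transpose_nonsing_inv]⟩

/-- The leverage `tr (H Λ⁻¹ Hᵀ)` of a feature matrix `H` with respect to a preconditioner `Λ`. -/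
def leverage (Λ : Matrix ι ι ℝ) (H : Matrix κ ι ℝ) : ℝ := (H * Λ⁻¹ * Hᵀ).trace

lemma leverage_nonneg {Λ : Matrix ι ι ℝ} (hΛ : Λ.PosDef) (H : Matrix κ ι ℝ) :
    0 ≤ leverage Λ H := by
  simpa only [leverage, conjTranspose_eq_transpose_of_trivial] using
    (hΛ.inv.posSemidef.mul_mul_conjTranspose_same H).trace_nonneg

lemma l2norm_mulVec_sq_le_leverage {Λ : Matrix ι ι ℝ} (hΛ : Λ.PosDef) (H : Matrix κ ι ℝ)
    (x : ι → ℝ) : l2norm (H *ᵥ x) ^ 2 ≤ leverage Λ H * (x ⬝ᵥ Λ *ᵥ x) := by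
  obtain ⟨E, F, hFE, hE, hF⟩ := exists_whitening hΛ
  calc l2norm (H *ᵥ x) ^ 2 = l2norm ((H * F) *ᵥ (E *ᵥ x)) ^ 2 := by
        rw [mulVec_mulVec, Matrix.mul_assoc, hFE, Matrix.mul_one]
    _ ≤ (H * F * (H * F)ᵀ).trace * l2norm (E *ᵥ x) ^ 2 := l2norm_mulVec_sq_le_trace _ _
    _ = leverage Λ H * (x ⬝ᵥ Λ *ᵥ x) := by
        rw [leverage, hF, transpose_mul, l2norm_sq_eq_dotProduct, hE, ← mulVec_mulVec,
          dotProduct_mulVec x, vecMul_transpose]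
        simp only [Matrix.mul_assoc]

lemma dotProduct_inv_mulVec_le_leverage {Λ : Matrix ι ι ℝ} (hΛ : Λ.PosDef) (H : Matrix κ ι ℝ)
    (g : κ → ℝ) : (Hᵀ *ᵥ g) ⬝ᵥ Λ⁻¹ *ᵥ (Hᵀ *ᵥ g) ≤ leverage Λ H * l2norm g ^ 2 := by
  obtain ⟨-, F, -, -, hF⟩ := exists_whitening hΛ
  calc (Hᵀ *ᵥ g) ⬝ᵥ Λ⁻¹ *ᵥ (Hᵀ *ᵥ g) = l2norm ((Fᵀ * Hᵀ) *ᵥ g) ^ 2 := by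
        rw [hF, ← mulVec_mulVec, dotProduct_mulVec, ← mulVec_transpose, mulVec_mulVec,
          l2norm_sq_eq_dotProduct]
    _ ≤ (Fᵀ * Hᵀ * (Fᵀ * Hᵀ)ᵀ).trace * l2norm g ^ 2 := l2norm_mulVec_sq_le_trace _ _
    _ = leverage Λ H * l2norm g ^ 2 := by
        rw [trace_mul_comm, ← transpose_mul, transpose_transpose, transpose_mul, leverage, hF]
        simp only [Matrix.mul_assoc]

lemma det_le_exp_trace_sub_card {X : Matrix ι ι ℝ} (hX : X.PosSemidef) :
    X.det ≤ Real.exp (X.trace - Fintype.card ι) := by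
  calc X.det = ∏ i, hX.1.eigenvalues i := hX.1.det_eq_prod_eigenvalues
    _ ≤ ∏ i, Real.exp (hX.1.eigenvalues i - 1) :=
        Finset.prod_le_prod (fun i _ => hX.eigenvalues_nonneg i) fun i _ => by
          simpa using Real.add_one_le_exp (hX.1.eigenvalues i - 1)
    _ = Real.exp (X.trace - Fintype.card ι) := by
        rw [← Real.exp_sum, hX.1.trace_eq_sum_eigenvalues]
        simp

lemma det_mul_det_le_exp_trace {P Q : Matrix ι ι ℝ} (hP : P.PosSemidef) (hQ : Q.PosSemidef) :
    P.det * Q.det ≤ Real.exp ((P * Q).trace - Fintype.card ι) := by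
  obtain ⟨B, rfl⟩ := exists_eq_transpose_mul_self hQ
  have := det_le_exp_trace_sub_card (hP.mul_mul_conjTranspose_same B)
  rw [conjTranspose_eq_transpose_of_trivial, trace_mul_comm, ← Matrix.mul_assoc, trace_mul_comm]
    at this
  simpa only [det_mul, det_transpose, mul_comm, mul_left_comm] using this

-- This is `log det X ≤ tr X - n` for `X = Λ (Λ + Hᵀ H)⁻¹ = 1 - Hᵀ H (Λ + Hᵀ H)⁻¹`.
lemma leverage_le_log_det_sub_log_det {Λ : Matrix ι ι ℝ} (hΛ : Λ.PosDef) (H : Matrix κ ι ℝ) :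
    leverage (Λ + Hᵀ * H) H ≤ Real.log (Λ + Hᵀ * H).det - Real.log Λ.det := by
  have hN := posDef_add_transpose_mul_self hΛ H
  set N := Λ + Hᵀ * H with N_def
  have trace_eq : (N⁻¹ * Λ).trace - Fintype.card ι = -leverage N H := by
    rw [eq_sub_of_add_eq N_def.symm, Matrix.mul_sub, nonsing_inv_mul _ hN.det_pos.ne'.isUnit,
      trace_sub, trace_one, leverage, Matrix.mul_assoc, trace_mul_comm H, Matrix.mul_assoc]
    ring
  have det_bound : N.det⁻¹ * Λ.det ≤ Real.exp (-leverage N H) := by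
    simpa only [trace_eq, det_nonsing_inv, Ring.inverse_eq_inv'] using
      det_mul_det_le_exp_trace hN.inv.posSemidef hΛ.posSemidef
  have log_bound := Real.log_le_log (mul_pos (inv_pos.2 hN.det_pos) hΛ.det_pos) det_bound
  rw [Real.log_exp, Real.log_mul (inv_pos.2 hN.det_pos).ne' hΛ.det_pos.ne', Real.log_inv]
    at log_bound
  linarith

lemma log_det_le_of_trace_le {Λ : Matrix ι ι ℝ} (hΛ : Λ.PosDef) {c : ℝ} (hc : 0 < c)
    (trace_le : Λ.trace ≤ c * Fintype.card ι) :
    Real.log Λ.det ≤ Fintype.card ι * Real.log c := by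
  have scaled_det_le_one : c⁻¹ ^ Fintype.card ι * Λ.det ≤ 1 := by
    rw [← det_smul]
    refine (det_le_exp_trace_sub_card (hΛ.posSemidef.smul (inv_pos.2 hc).le)).trans ?_
    rwa [Real.exp_le_one_iff, trace_smul, smul_eq_mul, sub_nonpos, inv_mul_le_iff₀ hc]
  rw [← Real.log_pow]
  refine Real.log_le_log hΛ.det_pos ?_
  rwa [inv_pow, inv_mul_le_iff₀ (pow_pos hc _), mul_one] at scaled_det_le_one

end Leverage

/-! ### Weighted projections and semi-Newton steps -/

section Projection

variable {ι κ : Type*}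

lemma isSymm_of_posSemidef {Λ : Matrix ι ι ℝ} (hΛ : Λ.PosSemidef) : Λ.IsSymm := by
  simpa only [IsSymm, conjTranspose_eq_transpose_of_trivial] using hΛ.isHermitian.eq

variable [Fintype ι] [Fintype κ]

/-- The quadratic form `xᵀ Λ x`, i.e. the squared norm `‖Λ^{1/2} x‖²` when `Λ` is positive
semidefinite. -/
def quadForm (Λ : Matrix ι ι ℝ) (x : ι → ℝ) : ℝ := x ⬝ᵥ Λ *ᵥ x

lemma quadForm_nonneg {Λ : Matrix ι ι ℝ} (hΛ : Λ.PosSemidef) (x : ι → ℝ) : 0 ≤ quadForm Λ x := by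
  simpa only [quadForm, star_trivial] using hΛ.dotProduct_mulVec_nonneg x

@[simp] lemma quadForm_zero (Λ : Matrix ι ι ℝ) : quadForm Λ 0 = 0 := zero_dotProduct _

lemma quadForm_neg (Λ : Matrix ι ι ℝ) (x : ι → ℝ) : quadForm Λ (-x) = quadForm Λ x := by
  simp only [quadForm, mulVec_neg, neg_dotProduct_neg]

lemma quadForm_add_transpose_mul_self (Λ : Matrix ι ι ℝ) (H : Matrix κ ι ℝ) (x : ι → ℝ) :
    quadForm (Λ + Hᵀ * H) x = quadForm Λ x + l2norm (H *ᵥ x) ^ 2 := by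
  rw [quadForm, add_mulVec, dotProduct_add, ← mulVec_mulVec, dotProduct_mulVec x Hᵀ,
    vecMul_transpose, l2norm_sq_eq_dotProduct, quadForm]

lemma quadForm_add_smul {Λ : Matrix ι ι ℝ} (hΛ : Λ.IsSymm) (x d : ι → ℝ) (s : ℝ) :
    quadForm Λ (x + s • d) = quadForm Λ x + s * (2 * (d ⬝ᵥ Λ *ᵥ x)) + s ^ 2 * quadForm Λ d := by
  have symm : x ⬝ᵥ Λ *ᵥ d = d ⬝ᵥ Λ *ᵥ x := by
    rw [dotProduct_mulVec, ← mulVec_transpose, hΛ.eq, dotProduct_comm]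
  simp only [quadForm, mulVec_add, mulVec_smul, dotProduct_add, add_dotProduct, dotProduct_smul,
    smul_dotProduct, smul_eq_mul, symm]
  ring

lemma nonneg_of_forall_nonneg_mul_add_sq_mul {b c : ℝ}
    (h : ∀ s ∈ Set.Ioo (0 : ℝ) 1, 0 ≤ s * b + s ^ 2 * c) : 0 ≤ b := by
  have tendsto_b : Filter.Tendsto (fun s : ℝ => b + s * c) (nhdsWithin 0 (Set.Ioi 0)) (nhds b) := by
    have : Continuous fun s : ℝ => b + s * c := by fun_prop
    simpa using (this.tendsto 0).mono_left nhdsWithin_le_nhds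
  refine ge_of_tendsto tendsto_b ?_
  filter_upwards [Ioo_mem_nhdsGT zero_lt_one] with s hs
  exact nonneg_of_mul_nonneg_right (by linarith [h s hs]) hs.1

variable {S : Set (EuclideanSpace ℝ ι)} {Λ : Matrix ι ι ℝ}

lemma weightedProj_spec (hS : IsCompact S) (hne : S.Nonempty) (Λ : Matrix ι ι ℝ)
    (p : EuclideanSpace ℝ ι) :
    weightedProj S Λ p ∈ S ∧
      IsMinOn (fun q : EuclideanSpace ℝ ι => quadForm Λ (q - p).ofLp) S (weightedProj S Λ p) := by
  have exists_min : ∃ z ∈ S,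
      IsMinOn (fun q : EuclideanSpace ℝ ι => quadForm Λ (q - p).ofLp) S z := by
    refine hS.exists_isMinOn hne (Continuous.continuousOn ?_)
    simp only [quadForm, dotProduct, mulVec]
    fun_prop
  have proj_eq : weightedProj S Λ p = exists_min.choose := dif_pos exists_min
  exact proj_eq ▸ exists_min.choose_spec

lemma weightedProj_mem (hS : IsCompact S) (hne : S.Nonempty) (Λ : Matrix ι ι ℝ)
    (p : EuclideanSpace ℝ ι) : weightedProj S Λ p ∈ S :=
  (weightedProj_spec hS hne Λ p).1

lemma dotProduct_mulVec_weightedProj_sub_nonneg (hS : IsCompact S) (hconv : Convex ℝ S)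
    (hΛ : Λ.PosSemidef) (p : EuclideanSpace ℝ ι) {q : EuclideanSpace ℝ ι} (hq : q ∈ S) :
    0 ≤ (q - weightedProj S Λ p).ofLp ⬝ᵥ Λ *ᵥ (weightedProj S Λ p - p).ofLp := by
  obtain ⟨proj_mem, proj_min⟩ := weightedProj_spec hS ⟨q, hq⟩ Λ p
  set z := weightedProj S Λ p
  refine nonneg_of_mul_nonneg_right (a := 2)
    (nonneg_of_forall_nonneg_mul_add_sq_mul (c := quadForm Λ (q - z).ofLp) fun s hs => ?_) two_pos
  have segment_mem : z + s • (q - z) ∈ S :=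
    hconv.add_smul_sub_mem proj_mem hq ⟨hs.1.le, hs.2.le⟩
  have min_le : quadForm Λ (z - p).ofLp ≤ quadForm Λ (z + s • (q - z) - p).ofLp :=
    proj_min segment_mem
  rw [add_sub_right_comm, WithLp.ofLp_add, WithLp.ofLp_smul,
    quadForm_add_smul (isSymm_of_posSemidef hΛ)] at min_le
  linarith

lemma quadForm_weightedProj_sub_le (hS : IsCompact S) (hconv : Convex ℝ S) (hΛ : Λ.PosSemidef)
    (p : EuclideanSpace ℝ ι) {q : EuclideanSpace ℝ ι} (hq : q ∈ S) :
    quadForm Λ (weightedProj S Λ p - q).ofLp ≤ quadForm Λ (p - q).ofLp := by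
  have obtuse := dotProduct_mulVec_weightedProj_sub_nonneg hS hconv hΛ p hq
  set z := weightedProj S Λ p
  have decomposition : (p - q).ofLp = -((z - p).ofLp + (1 : ℝ) • (q - z).ofLp) := by
    rw [one_smul, ← WithLp.ofLp_add, ← WithLp.ofLp_neg]
    congr 1
    abel
  rw [decomposition, quadForm_neg, quadForm_add_smul (isSymm_of_posSemidef hΛ), ← neg_sub q z,
    WithLp.ofLp_neg, quadForm_neg]
  linarith [quadForm_nonneg hΛ (z - p).ofLp]

variable [DecidableEq ι]

lemma quadForm_newton_step_sub_le (hS : IsCompact S) (hconv : Convex ℝ S) (hΛ : Λ.PosDef) (η : ℝ)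
    (z : EuclideanSpace ℝ ι) (g : ι → ℝ) {q : EuclideanSpace ℝ ι} (hq : q ∈ S) :
    quadForm Λ (weightedProj S Λ (z - η • WithLp.toLp 2 (Λ⁻¹ *ᵥ g)) - q).ofLp ≤
      quadForm Λ (z - q).ofLp - 2 * η * (g ⬝ᵥ (z - q).ofLp) + η ^ 2 * (g ⬝ᵥ Λ⁻¹ *ᵥ g) := by
  refine (quadForm_weightedProj_sub_le hS hconv hΛ.posSemidef _ hq).trans_eq ?_
  have isUnit_det : IsUnit Λ.det := hΛ.det_pos.ne'.isUnit
  have symm := isSymm_of_posSemidef hΛ.posSemidef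
  have cross_term : (Λ⁻¹ *ᵥ g) ⬝ᵥ Λ *ᵥ (z - q).ofLp = g ⬝ᵥ (z - q).ofLp := by
    rw [← vecMul_transpose, transpose_nonsing_inv, symm.eq, ← dotProduct_mulVec, mulVec_mulVec,
      nonsing_inv_mul _ isUnit_det, one_mulVec]
  have square_term : quadForm Λ (Λ⁻¹ *ᵥ g) = g ⬝ᵥ Λ⁻¹ *ᵥ g := by
    rw [quadForm, mulVec_mulVec, mul_nonsing_inv _ isUnit_det, one_mulVec, dotProduct_comm]
  have shift : (z - η • WithLp.toLp 2 (Λ⁻¹ *ᵥ g) - q).ofLp =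
      (z - q).ofLp + (-η) • (Λ⁻¹ *ᵥ g) := by
    simp only [WithLp.ofLp_sub, WithLp.ofLp_smul]
    module
  rw [shift, quadForm_add_smul symm, cross_term, square_term]
  ring

end Projection

/-! ### Regularized Gram matrices and the elliptical potential -/

section Gram

variable {ι κ : Type*} [Fintype κ] [DecidableEq ι] {lam : ℝ} {H : ℕ → Matrix κ ι ℝ}

/-- The regularized Gram matrix `lam • I + ∑_{s < t} H_sᵀ H_s`. -/
def regGram (lam : ℝ) (H : ℕ → Matrix κ ι ℝ) (t : ℕ) : Matrix ι ι ℝ :=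
  lam • 1 + ∑ s ∈ Finset.range t, (H s)ᵀ * H s

@[simp] lemma regGram_zero : regGram lam H 0 = lam • 1 := by simp [regGram]

lemma regGram_succ (t : ℕ) : regGram lam H (t + 1) = regGram lam H t + (H t)ᵀ * H t := by
  rw [regGram, Finset.sum_range_succ, ← add_assoc, regGram]

lemma posDef_regGram [Finite ι] (hlam : 0 < lam) (H : ℕ → Matrix κ ι ℝ) (t : ℕ) :
    (regGram lam H t).PosDef := by
  induction t with
  | zero =>
    rw [regGram_zero]
    exact PosDef.one.smul hlam
  | succ t ih =>
    rw [regGram_succ]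
    exact posDef_add_transpose_mul_self ih _

variable [Fintype ι]

/-- The leverage of the feature matrix of round `t` with respect to the Gram matrix that already
includes round `t`. -/
def roundLeverage (lam : ℝ) (H : ℕ → Matrix κ ι ℝ) (t : ℕ) : ℝ :=
  leverage (regGram lam H (t + 1)) (H t)

lemma roundLeverage_nonneg (hlam : 0 < lam) (H : ℕ → Matrix κ ι ℝ) (t : ℕ) :
    0 ≤ roundLeverage lam H t :=
  leverage_nonneg (posDef_regGram hlam H _) _

lemma monotone_quadForm_regGram (x : ι → ℝ) : Monotone fun t => quadForm (regGram lam H t) x :=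
  monotone_nat_of_le_succ fun t => by
    rw [regGram_succ, quadForm_add_transpose_mul_self]
    exact le_add_of_nonneg_right (sq_nonneg _)

lemma trace_regGram_le (trace_le : ∀ t, ((H t)ᵀ * H t).trace ≤ lam * Fintype.card ι) (t : ℕ) :
    (regGram lam H t).trace ≤ lam * (1 + t) * Fintype.card ι := by
  induction t with
  | zero => simp [trace_smul]
  | succ t ih =>
    rw [regGram_succ, trace_add]
    push_cast
    linarith [trace_le t]

lemma sum_roundLeverage_le_log_det (hlam : 0 < lam) (H : ℕ → Matrix κ ι ℝ) (T : ℕ) :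
    ∑ t ∈ Finset.range T, roundLeverage lam H t ≤
      Real.log (regGram lam H T).det - Fintype.card ι * Real.log lam := by
  have log_det_zero : Real.log (regGram lam H 0).det = Fintype.card ι * Real.log lam := by
    rw [regGram_zero, det_smul, det_one, mul_one, Real.log_pow]
  rw [← log_det_zero, ← Finset.sum_range_sub fun t => Real.log (regGram lam H t).det]
  refine Finset.sum_le_sum fun t _ => ?_
  rw [roundLeverage, regGram_succ]
  exact leverage_le_log_det_sub_log_det (posDef_regGram hlam H t) _

theorem sum_roundLeverage_le (hlam : 0 < lam)
    (trace_le : ∀ t, ((H t)ᵀ * H t).trace ≤ lam * Fintype.card ι) (T : ℕ) :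
    ∑ t ∈ Finset.range T, roundLeverage lam H t ≤ Fintype.card ι * Real.log (1 + T) := by
  have log_det_le := log_det_le_of_trace_le (posDef_regGram hlam H T) (by positivity)
    (trace_regGram_le trace_le T)
  rw [Real.log_mul hlam.ne' (by positivity)] at log_det_le
  linarith [sum_roundLeverage_le_log_det hlam H T]

end Gram

/-! ### Online Newton iterates -/

section Newton

variable {ι κ : Type*} [Fintype ι] [Fintype κ] [DecidableEq ι]

/-- Projected semi-Newton iterates `z` in the compact convex set `S` for losses of the form
`z ↦ φ_t (H_t z)`, where `g t` is the gradient of `φ_t` at `H_t z_t`. -/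
structure NewtonIterates (S : Set (EuclideanSpace ℝ ι)) (η lam γ : ℝ) (H : ℕ → Matrix κ ι ℝ)
    (g : ℕ → κ → ℝ) (z : ℕ → EuclideanSpace ℝ ι) : Prop where
  compact : IsCompact S
  convex : Convex ℝ S
  η_pos : 0 < η
  lam_pos : 0 < lam
  mem : ∀ t, z t ∈ S
  succ : ∀ t, z (t + 1) = weightedProj S (regGram lam H (t + 1))
    (z t - η • WithLp.toLp 2 ((regGram lam H (t + 1))⁻¹ *ᵥ ((H t)ᵀ *ᵥ g t)))
  l2norm_le : ∀ t, l2norm (g t) ≤ γ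

namespace NewtonIterates

variable {S : Set (EuclideanSpace ℝ ι)} {η lam γ : ℝ} {H : ℕ → Matrix κ ι ℝ}
  {g : ℕ → κ → ℝ} {z : ℕ → EuclideanSpace ℝ ι}

lemma γ_nonneg (N : NewtonIterates S η lam γ H g z) : 0 ≤ γ :=
  (l2norm_nonneg _).trans (N.l2norm_le 0)

lemma quadForm_succ_sub_le (N : NewtonIterates S η lam γ H g z) {q : EuclideanSpace ℝ ι}
    (hq : q ∈ S) (t : ℕ) :
    quadForm (regGram lam H (t + 1)) (z (t + 1) - q).ofLp ≤
      quadForm (regGram lam H (t + 1)) (z t - q).ofLp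
        - 2 * η * (g t ⬝ᵥ H t *ᵥ (z t - q).ofLp) + η ^ 2 * (γ ^ 2 * roundLeverage lam H t) := by
  have hΛ := posDef_regGram N.lam_pos H (t + 1)
  have gradient_term : ((H t)ᵀ *ᵥ g t) ⬝ᵥ (regGram lam H (t + 1))⁻¹ *ᵥ ((H t)ᵀ *ᵥ g t) ≤
      γ ^ 2 * roundLeverage lam H t := by
    refine (dotProduct_inv_mulVec_le_leverage hΛ _ _).trans ?_
    rw [mul_comm]
    exact mul_le_mul_of_nonneg_right (pow_le_pow_left₀ (l2norm_nonneg _) (N.l2norm_le t) 2)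
      (roundLeverage_nonneg N.lam_pos H t)
  have newton_step := quadForm_newton_step_sub_le N.compact N.convex hΛ η (z t) ((H t)ᵀ *ᵥ g t) hq
  rw [← N.succ, mulVec_transpose (H t), ← dotProduct_mulVec, ← mulVec_transpose] at newton_step
  exact newton_step.trans
    (add_le_add_right (mul_le_mul_of_nonneg_left gradient_term (sq_nonneg η)) _)

-- The quadratic terms telescope: passing from `Λ_t` to `Λ_{t+1}` costs exactly `‖H_t (z_t - q)‖²`.
lemma sum_add_quadForm_le (N : NewtonIterates S η lam γ H g z) {q : EuclideanSpace ℝ ι}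
    (hq : q ∈ S) (T : ℕ) :
    ∑ t ∈ Finset.range T, (2 * η * (g t ⬝ᵥ H t *ᵥ (z t - q).ofLp) -
        l2norm (H t *ᵥ (z t - q).ofLp) ^ 2) + quadForm (regGram lam H T) (z T - q).ofLp ≤
      lam * ‖z 0 - q‖ ^ 2 + η ^ 2 * γ ^ 2 * ∑ t ∈ Finset.range T, roundLeverage lam H t := by
  induction T with
  | zero =>
    rw [Finset.sum_range_zero, Finset.sum_range_zero, regGram_zero, quadForm, smul_mulVec,
      one_mulVec, dotProduct_smul, ← l2norm_sq_eq_dotProduct, smul_eq_mul, mul_zero, zero_add,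
      add_zero]
    rfl
  | succ T ih =>
    have step := N.quadForm_succ_sub_le hq T
    rw [regGram_succ, quadForm_add_transpose_mul_self _ _ (z T - q).ofLp, ← regGram_succ] at step
    rw [Finset.sum_range_succ, Finset.sum_range_succ]
    linarith

theorem regret_le (N : NewtonIterates S η lam γ H g z) {q : EuclideanSpace ℝ ι} (hq : q ∈ S)
    (T : ℕ) :
    ∑ t ∈ Finset.range T, (g t ⬝ᵥ H t *ᵥ (z t - q).ofLp -
        1 / (2 * η) * l2norm (H t *ᵥ (z t - q).ofLp) ^ 2) ≤
      lam / (2 * η) * ‖z 0 - q‖ ^ 2 +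
        η * γ ^ 2 / 2 * ∑ t ∈ Finset.range T, roundLeverage lam H t := by
  have hη := N.η_pos
  have telescoped := (le_add_of_nonneg_right (quadForm_nonneg
    (posDef_regGram N.lam_pos H T).posSemidef _)).trans (N.sum_add_quadForm_le hq T)
  calc ∑ t ∈ Finset.range T, (g t ⬝ᵥ H t *ᵥ (z t - q).ofLp -
        1 / (2 * η) * l2norm (H t *ᵥ (z t - q).ofLp) ^ 2)
      = 1 / (2 * η) * ∑ t ∈ Finset.range T, (2 * η * (g t ⬝ᵥ H t *ᵥ (z t - q).ofLp) -
        l2norm (H t *ᵥ (z t - q).ofLp) ^ 2) := by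
        rw [Finset.mul_sum]
        refine Finset.sum_congr rfl fun t _ => ?_
        field_simp
    _ ≤ 1 / (2 * η) * (lam * ‖z 0 - q‖ ^ 2 +
        η ^ 2 * γ ^ 2 * ∑ t ∈ Finset.range T, roundLeverage lam H t) := by gcongr
    _ = _ := by field_simp

lemma quadForm_succ_sub_self_le (N : NewtonIterates S η lam γ H g z) (t : ℕ) :
    quadForm (regGram lam H (t + 1)) (z (t + 1) - z t).ofLp ≤
      (η * γ) ^ 2 * roundLeverage lam H t := by
  have := N.quadForm_succ_sub_le (N.mem t) t
  simp only [sub_self, WithLp.ofLp_zero, mulVec_zero, dotProduct_zero, quadForm_zero] at this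
  linarith

-- By AM-GM, since `‖H_s d‖² ≤ lev_s * quadForm Λ_{s+1} d ≤ lev_s * quadForm Λ_{t+1} d`.
lemma l2norm_mulVec_succ_sub_le (N : NewtonIterates S η lam γ H g z) {s t : ℕ} (hst : s ≤ t) :
    l2norm (H s *ᵥ (z (t + 1) - z t).ofLp) ≤
      η * γ / 2 * (roundLeverage lam H s + roundLeverage lam H t) := by
  have hη := N.η_pos
  have hγ := N.γ_nonneg
  have lev_s_nonneg := roundLeverage_nonneg N.lam_pos H s
  have lev_t_nonneg := roundLeverage_nonneg N.lam_pos H t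
  set d := (z (t + 1) - z t).ofLp
  refine le_of_sq_le_sq ?_ (by positivity)
  calc l2norm (H s *ᵥ d) ^ 2
      ≤ roundLeverage lam H s * quadForm (regGram lam H (s + 1)) d :=
        l2norm_mulVec_sq_le_leverage (posDef_regGram N.lam_pos H _) _ _
    _ ≤ roundLeverage lam H s * ((η * γ) ^ 2 * roundLeverage lam H t) := by
        gcongr
        exact (monotone_quadForm_regGram d (Nat.succ_le_succ hst)).trans
          (N.quadForm_succ_sub_self_le t)
    _ ≤ (η * γ) ^ 2 / 4 * (roundLeverage lam H s + roundLeverage lam H t) ^ 2 := by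
        nlinarith [mul_nonneg (sq_nonneg (η * γ))
          (sq_nonneg (roundLeverage lam H s - roundLeverage lam H t))]
    _ = (η * γ / 2 * (roundLeverage lam H s + roundLeverage lam H t)) ^ 2 := by ring

theorem l2norm_mulVec_add_sub_le (N : NewtonIterates S η lam γ H g z) (s i : ℕ) :
    l2norm (H s *ᵥ (z (s + i) - z s).ofLp) ≤ η * γ / 2 *
      ∑ k ∈ Finset.range i, (roundLeverage lam H s + roundLeverage lam H (s + k)) := by
  have telescope : (z (s + i) - z s).ofLp =
      ∑ k ∈ Finset.range i, (z (s + k + 1) - z (s + k)).ofLp := by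
    rw [← WithLp.ofLp_sum]
    exact congrArg _ (Finset.sum_range_sub (fun k => z (s + k)) i).symm
  rw [telescope, mulVec_sum, Finset.mul_sum]
  exact (l2norm_sum_le _ _).trans
    (Finset.sum_le_sum fun k _ => N.l2norm_mulVec_succ_sub_le (Nat.le_add_right s k))

end NewtonIterates

end Newton

/-! ### Delayed and geometric sums -/

section Sums

lemma sum_range_sum_delayed_le {l w : ℕ → ℝ} (hl : ∀ t, 0 ≤ l t) (hw : ∀ i, 0 ≤ w i) (T : ℕ) :
    ∑ t ∈ Finset.range T, ∑ i ∈ Finset.range (t + 1),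
        w i * ∑ k ∈ Finset.range i, (l (t - i) + l (t - i + k)) ≤
      (∑ i ∈ Finset.range T, i * w i) * (2 * ∑ t ∈ Finset.range T, l t) := by
  have shifted_sum_le {i k : ℕ} (hk : k ≤ i) :
      ∑ s ∈ Finset.range (T - i), l (s + k) ≤ ∑ t ∈ Finset.range T, l t := by
    rw [Finset.range_eq_Ico, Finset.sum_Ico_add']
    refine Finset.sum_le_sum_of_subset_of_nonneg (fun t ht => ?_) fun t _ _ => hl t
    simp only [Finset.mem_Ico, Finset.mem_range] at *
    omega
  rw [Finset.sum_range_diag_flip T fun i s => w i * ∑ k ∈ Finset.range i, (l s + l (s + k)),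
    Finset.sum_mul]
  refine Finset.sum_le_sum fun i _ => ?_
  calc ∑ s ∈ Finset.range (T - i), w i * ∑ k ∈ Finset.range i, (l s + l (s + k))
      = w i * ∑ k ∈ Finset.range i, (∑ s ∈ Finset.range (T - i), l (s + 0) +
          ∑ s ∈ Finset.range (T - i), l (s + k)) := by
        rw [← Finset.mul_sum, Finset.sum_comm]
        simp only [Finset.sum_add_distrib, add_zero]
    _ ≤ w i * ∑ _k ∈ Finset.range i, 2 * ∑ t ∈ Finset.range T, l t := by
        refine mul_le_mul_of_nonneg_left (Finset.sum_le_sum fun k hk => ?_) (hw i)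
        linarith [shifted_sum_le (Nat.zero_le i), shifted_sum_le (Finset.mem_range.1 hk).le]
    _ = i * w i * (2 * ∑ t ∈ Finset.range T, l t) := by
        rw [Finset.sum_const, Finset.card_range, nsmul_eq_mul]
        ring

variable {ρ : ℝ}

lemma sum_range_pow_le (hρ : 0 ≤ ρ) (hρ1 : ρ < 1) (n : ℕ) :
    ∑ i ∈ Finset.range n, ρ ^ i ≤ 1 / (1 - ρ) := by
  simpa only [Nat.Ico_zero_eq_range, pow_zero] using
    geom_sum_Ico_le_of_lt_one (m := 0) (n := n) hρ hρ1

lemma sum_range_natCast_mul_pow_le (hρ : 0 ≤ ρ) (hρ1 : ρ < 1) (n : ℕ) :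
    ∑ i ∈ Finset.range n, (i : ℝ) * ρ ^ i ≤ 1 / (1 - ρ) ^ 2 := by
  have series := hasSum_coe_mul_geometric_of_norm_lt_one (r := ρ) (by rwa [Real.norm_of_nonneg hρ])
  exact (sum_le_hasSum (Finset.range n) (fun i _ => by positivity) series).trans
    (div_le_div_of_nonneg_right hρ1.le (sq_nonneg _))

lemma pow_ceil_log_le (hρ : 0 < ρ) (hρ1 : ρ < 1) {T : ℕ} (hT : 0 < T) :
    ρ ^ ⌈Real.log T / (1 - ρ)⌉₊ ≤ 1 / T := by
  have T_pos : (0 : ℝ) < T := Nat.cast_pos.2 hT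
  have log_le := Nat.le_ceil (Real.log T / (1 - ρ))
  set n := ⌈Real.log T / (1 - ρ)⌉₊
  rw [div_le_iff₀ (sub_pos.2 hρ1)] at log_le
  have pow_le_exp : ρ ^ n ≤ Real.exp (-(n * (1 - ρ))) := by
    rw [← mul_neg, Real.exp_nat_mul]
    exact pow_le_pow_left₀ hρ.le (by linarith [Real.add_one_le_exp (-(1 - ρ))]) n
  calc ρ ^ n ≤ Real.exp (-(n * (1 - ρ))) := pow_le_exp
    _ ≤ Real.exp (-Real.log T) := Real.exp_le_exp.2 (neg_le_neg log_le)
    _ = 1 / T := by rw [Real.exp_neg, Real.exp_log T_pos, one_div]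

lemma one_le_log_one_add {x : ℝ} (hx : 2 ≤ x) : 1 ≤ Real.log (1 + x) := by
  rw [Real.le_log_iff_exp_le (by linarith)]
  linarith [Real.exp_one_lt_three]

lemma ceil_log_div_one_sub_le (hρ : 0 ≤ ρ) (hρ1 : ρ < 1) {x : ℝ} (hx : 2 ≤ x) :
    (⌈Real.log x / (1 - ρ)⌉₊ : ℝ) ≤ 2 * Real.log (1 + x) * (1 / (1 - ρ)) := by
  have one_sub_pos : 0 < 1 - ρ := sub_pos.2 hρ1
  have log_nonneg : 0 ≤ Real.log x := Real.log_nonneg (by linarith)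
  have one_le_quotient : 1 ≤ Real.log (1 + x) / (1 - ρ) := by
    rw [one_le_div one_sub_pos]
    linarith [one_le_log_one_add hx]
  calc (⌈Real.log x / (1 - ρ)⌉₊ : ℝ)
      ≤ Real.log x / (1 - ρ) + 1 :=
        (Nat.ceil_lt_add_one (div_nonneg log_nonneg one_sub_pos.le)).le
    _ ≤ Real.log (1 + x) / (1 - ρ) + Real.log (1 + x) / (1 - ρ) := by
        gcongr
        linarith
    _ = 2 * Real.log (1 + x) * (1 / (1 - ρ)) := by ring

lemma ceil_log_div_one_sub_pos (hρ1 : ρ < 1) {x : ℝ} (hx : 1 < x) :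
    0 < ⌈Real.log x / (1 - ρ)⌉₊ :=
  Nat.ceil_pos.2 (div_pos (Real.log_pos hx) (sub_pos.2 hρ1))

end Sums

/-! ### Causal convolutions and Markov parameters -/

section Convolution

variable {R κ ι σ : Type*} [Fintype ι] [Fintype σ]

/-- The causal convolution `∑_{i ≤ t} G_i u_{t-i}`, i.e. the response at time `t` of the linear
time-invariant system with Markov parameters `G` to the inputs `u`. -/
def conv [NonUnitalNonAssocSemiring R] (G : ℕ → Matrix κ ι R) (u : ℕ → ι → R) (t : ℕ) : κ → R :=
  ∑ i ∈ Finset.range (t + 1), G i *ᵥ u (t - i)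

/-- The Markov parameters `D, C B, C A B, C A² B, …` of the system
`x_{t+1} = A x_t + B u_t`, `y_t = C x_t + D u_t`. -/
def markovParam [Semiring R] [DecidableEq σ] (A : Matrix σ σ R) (B : Matrix σ ι R)
    (C : Matrix κ σ R) (D : Matrix κ ι R) : ℕ → Matrix κ ι R
  | 0 => D
  | i + 1 => C * A ^ i * B

/-- The Markov parameters of index `< n`, the later ones being replaced by `0`. -/
def truncate [Zero R] (n : ℕ) (G : ℕ → Matrix κ ι R) (i : ℕ) : Matrix κ ι R :=
  if i < n then G i else 0

lemma conv_eq_sum_reflect [NonUnitalNonAssocSemiring R] (G : ℕ → Matrix κ ι R) (u : ℕ → ι → R)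
    (t : ℕ) : conv G u t = ∑ i ∈ Finset.range (t + 1), G (t - i) *ᵥ u i := by
  rw [conv, ← Finset.sum_range_reflect]
  refine Finset.sum_congr rfl fun i hi => ?_
  have : i ≤ t := Nat.lt_succ_iff.1 (Finset.mem_range.1 hi)
  rw [show t + 1 - 1 - i = t - i by omega, Nat.sub_sub_self this]

lemma conv_sub_left [NonUnitalNonAssocRing R] (G G' : ℕ → Matrix κ ι R) (u : ℕ → ι → R) (t : ℕ) :
    conv (G - G') u t = conv G u t - conv G' u t := by
  simp only [conv, Pi.sub_apply, sub_mulVec, Finset.sum_sub_distrib]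

lemma conv_sub_right [NonUnitalNonAssocRing R] (G : ℕ → Matrix κ ι R) (u u' : ℕ → ι → R) (t : ℕ) :
    conv G (u - u') t = conv G u t - conv G u' t := by
  simp only [conv, Pi.sub_apply, mulVec_sub, Finset.sum_sub_distrib]

lemma mulVec_conv [NonUnitalSemiring R] [Fintype κ] {ν : Type*} (M : Matrix ν κ R)
    (G : ℕ → Matrix κ ι R) (u : ℕ → ι → R) (t : ℕ) :
    M *ᵥ conv G u t = conv (fun i => M * G i) u t := by
  simp only [conv, mulVec_sum, mulVec_mulVec]

lemma conv_truncate [NonUnitalNonAssocSemiring R] (n : ℕ) (G : ℕ → Matrix κ ι R)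
    (u : ℕ → ι → R) (t : ℕ) :
    conv (truncate n G) u t =
      ∑ i ∈ Finset.range n, if i ≤ t then G i *ᵥ u (t - i) else 0 := by
  have truncate_mulVec (i : ℕ) (v : ι → R) :
      truncate n G i *ᵥ v = if i < n then G i *ᵥ v else 0 := by
    unfold truncate
    split_ifs
    exacts [rfl, zero_mulVec v]
  simp only [conv, truncate_mulVec]
  rw [← Finset.sum_filter, ← Finset.sum_filter]
  refine Finset.sum_congr ?_ fun _ _ => rfl
  ext i
  simp only [Finset.mem_filter, Finset.mem_range, Nat.lt_succ_iff, and_comm]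

variable [Semiring R] [DecidableEq σ]

lemma eq_sum_pow_mulVec_of_forall_succ {A : Matrix σ σ R} {b x : ℕ → σ → R} (zero : x 0 = 0)
    (succ : ∀ t, x (t + 1) = A *ᵥ x t + b t) (t : ℕ) :
    x t = ∑ i ∈ Finset.range t, (A ^ i) *ᵥ b (t - (i + 1)) := by
  induction t with
  | zero => exact zero
  | succ t ih =>
    rw [succ, ih, Finset.sum_range_succ', mulVec_sum]
    simp only [pow_succ', ← mulVec_mulVec, pow_zero, one_mulVec, Nat.add_sub_add_right,
      zero_add, Nat.add_sub_cancel]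

theorem mulVec_add_eq_conv_markovParam {A : Matrix σ σ R} {B : Matrix σ ι R} {x : ℕ → σ → R}
    {u : ℕ → ι → R} (zero : x 0 = 0) (succ : ∀ t, x (t + 1) = A *ᵥ x t + B *ᵥ u t)
    (C : Matrix κ σ R) (D : Matrix κ ι R) (t : ℕ) :
    C *ᵥ x t + D *ᵥ u t = conv (markovParam A B C D) u t := by
  rw [conv, Finset.sum_range_succ', eq_sum_pow_mulVec_of_forall_succ zero succ, mulVec_sum]
  simp only [markovParam, ← mulVec_mulVec, Nat.sub_zero]

end Convolution

section ConvolutionBounds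

variable {κ ι : Type*} [Fintype κ] [Fintype ι] [DecidableEq ι] {G : ℕ → Matrix κ ι ℝ}
  {u : ℕ → ι → ℝ} {c ρ r : ℝ}

lemma l2norm_conv_le {b : ℕ → ℝ} (hG : ∀ i, opNorm (G i) ≤ b i) (hu : ∀ s, l2norm (u s) ≤ r)
    (t : ℕ) : l2norm (conv G u t) ≤ (∑ i ∈ Finset.range (t + 1), b i) * r := by
  rw [Finset.sum_mul]
  refine (l2norm_sum_le _ _).trans (Finset.sum_le_sum fun i _ => ?_)
  exact (l2norm_mulVec_le _ _).trans (mul_le_mul (hG i) (hu _) (l2norm_nonneg _)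
    ((opNorm_nonneg _).trans (hG i)))

lemma l2norm_conv_le_of_geometric (hc : 0 ≤ c) (hρ : 0 ≤ ρ) (hρ1 : ρ < 1)
    (hG : ∀ n, opNorm (G n) ≤ c * ρ ^ n) (hu : ∀ s, l2norm (u s) ≤ r) (t : ℕ) :
    l2norm (conv G u t) ≤ c / (1 - ρ) * r := by
  have r_nonneg : 0 ≤ r := (l2norm_nonneg _).trans (hu 0)
  refine (l2norm_conv_le hG hu t).trans (mul_le_mul_of_nonneg_right ?_ r_nonneg)
  rw [← Finset.mul_sum, div_eq_mul_one_div]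
  exact mul_le_mul_of_nonneg_left (sum_range_pow_le hρ hρ1 _) hc

lemma opNorm_truncate_le (hc : 0 ≤ c) (hρ : 0 ≤ ρ) (hG : ∀ n, opNorm (G n) ≤ c * ρ ^ n)
    (n i : ℕ) : opNorm (truncate n G i) ≤ c * ρ ^ i := by
  unfold truncate
  split_ifs
  · exact hG i
  · simpa only [opNorm, map_zero, norm_zero] using mul_nonneg hc (pow_nonneg hρ i)

lemma sum_range_tail_le (hρ : 0 ≤ ρ) (hρ1 : ρ < 1) (n N : ℕ) :
    ∑ i ∈ Finset.range N, (if i < n then 0 else ρ ^ i) ≤ ρ ^ n / (1 - ρ) := by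
  simp only [← not_le (a := n), ite_not]
  rw [← Finset.sum_filter]
  refine (geom_sum_Ico_le_of_lt_one (m := n) (n := N) hρ hρ1).trans' (le_of_eq ?_)
  congr 1
  ext i
  simp only [Finset.mem_filter, Finset.mem_range, Finset.mem_Ico, and_comm]

lemma l2norm_conv_sub_conv_truncate_le (hc : 0 ≤ c) (hρ : 0 ≤ ρ) (hρ1 : ρ < 1)
    (hG : ∀ n, opNorm (G n) ≤ c * ρ ^ n) (hu : ∀ s, l2norm (u s) ≤ r) (n t : ℕ) :
    l2norm (conv G u t - conv (truncate n G) u t) ≤ c / (1 - ρ) * r * ρ ^ n := by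
  have r_nonneg : 0 ≤ r := (l2norm_nonneg _).trans (hu 0)
  have tail_le (i : ℕ) : opNorm ((G - truncate n G) i) ≤ c * if i < n then 0 else ρ ^ i := by
    rw [Pi.sub_apply, truncate]
    split_ifs
    · rw [sub_self, mul_zero, opNorm, map_zero, map_zero, norm_zero]
    · rw [sub_zero]
      exact hG i
  rw [← conv_sub_left]
  calc l2norm (conv (G - truncate n G) u t)
      ≤ (∑ i ∈ Finset.range (t + 1), c * if i < n then 0 else ρ ^ i) * r :=
        l2norm_conv_le tail_le hu t
    _ ≤ c * (ρ ^ n / (1 - ρ)) * r := by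
        rw [← Finset.mul_sum]
        gcongr
        exact sum_range_tail_le hρ hρ1 n (t + 1)
    _ = c / (1 - ρ) * r * ρ ^ n := by ring

end ConvolutionBounds

/-! ### Trajectories under a static feedback and exogenous inputs -/

section Dynamics

variable {dx du dy : ℕ} {P : Plant dx du dy} {K : Matrix (Fin du) (Fin dy) ℝ}

/-- The outputs `C x_t + e_t` along a state trajectory `x`. -/
def Plant.output (P : Plant dx du dy) (x : ℕ → Vec dx) (t : ℕ) : Vec dy :=
  P.C *ᵥ x t + P.e t

/-- `x` is the state trajectory of `P` under the controls `K y_t + u_t`. -/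
structure IsDriven (P : Plant dx du dy) (K : Matrix (Fin du) (Fin dy) ℝ) (x : ℕ → Vec dx)
    (u : ℕ → Vec du) : Prop where
  zero : x 0 = P.x₁
  succ : ∀ t, x (t + 1) = P.A *ᵥ x t + P.B *ᵥ (K *ᵥ P.output x t + u t) + P.w t

/-- The iterates `(y_t, K y_t + u_t)` along a state trajectory `x` with exogenous inputs `u`. -/
def drivenIterate (P : Plant dx du dy) (K : Matrix (Fin du) (Fin dy) ℝ) (x : ℕ → Vec dx)
    (u : ℕ → Vec du) (t : ℕ) : Sig dy du :=
  pair (P.output x t) (K *ᵥ P.output x t + u t)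

lemma markovK_eq_markovParam (P : Plant dx du dy) (K : Matrix (Fin du) (Fin dy) ℝ) :
    markovK P K =
      markovParam (P.A + P.B * K * P.C) P.B (fromRows P.C (K * P.C)) (fromRows 0 1) := by
  funext i
  cases i <;> rfl

lemma IsDriven.sub_succ {x x' : ℕ → Vec dx} {u u' : ℕ → Vec du} (hx : IsDriven P K x u)
    (hx' : IsDriven P K x' u') (t : ℕ) :
    (x - x') (t + 1) = (P.A + P.B * K * P.C) *ᵥ (x - x') t + P.B *ᵥ (u - u') t := by
  simp only [Pi.sub_apply, hx.succ, hx'.succ, Plant.output, add_mulVec, mulVec_add, mulVec_sub,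
    ← mulVec_mulVec]
  abel

theorem IsDriven.iterate_sub_iterate {x x' : ℕ → Vec dx} {u u' : ℕ → Vec du}
    (hx : IsDriven P K x u) (hx' : IsDriven P K x' u') (t : ℕ) :
    drivenIterate P K x u t - drivenIterate P K x' u' t =
      WithLp.toLp 2 (conv (markovK P K) (u - u') t) := by
  have zero : (x - x') 0 = 0 := by rw [Pi.sub_apply, hx.zero, hx'.zero, sub_self]
  rw [markovK_eq_markovParam, ← mulVec_add_eq_conv_markovParam zero (hx.sub_succ hx'),
    drivenIterate, drivenIterate, pair, pair, ← WithLp.toLp_sub, fromRows_mulVec, fromRows_mulVec,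
    zero_mulVec, one_mulVec, ← Sum.elim_sub_sub, ← Sum.elim_add_add]
  simp only [Plant.output, Pi.sub_apply, mulVec_add, mulVec_sub, ← mulVec_mulVec]
  congr 2 <;> abel

/-- The plant states under the linear dynamic controller `π`. -/
def ldcX (P : Plant dx du dy) (π : LDC du dy) (t : ℕ) : Vec dx := (ldcState P π t).1

/-- The exogenous input `u_t - K y_t` played by the linear dynamic controller `π`. -/
def ldcEx (P : Plant dx du dy) (K : Matrix (Fin du) (Fin dy) ℝ) (π : LDC du dy) (t : ℕ) : Vec du :=
  π.C *ᵥ (ldcState P π t).2 + (π.D - K) *ᵥ P.output (ldcX P π) t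

/-- Nature's outputs `y_t^K`, under `u_t = K y_t`. -/
def natY (P : Plant dx du dy) (K : Matrix (Fin du) (Fin dy) ℝ) : ℕ → Vec dy :=
  P.output (ldcX P (LDC.static K))

lemma isDriven_ldcX (P : Plant dx du dy) (K : Matrix (Fin du) (Fin dy) ℝ) (π : LDC du dy) :
    IsDriven P K (ldcX P π) (ldcEx P K π) where
  zero := rfl
  succ t := by
    simp only [ldcX, ldcState, ldcEx, Plant.output, sub_mulVec]
    congr 3
    abel

lemma ldcIterate_eq_drivenIterate (P : Plant dx du dy) (K : Matrix (Fin du) (Fin dy) ℝ)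
    (π : LDC du dy) (t : ℕ) :
    ldcIterate P π t = drivenIterate P K (ldcX P π) (ldcEx P K π) t := by
  simp only [ldcIterate, drivenIterate, ldcEx, ldcX, Plant.output, sub_mulVec]
  congr 1
  abel

lemma ldcEx_static (P : Plant dx du dy) (K : Matrix (Fin du) (Fin dy) ℝ) :
    ldcEx P K (LDC.static K) = 0 := by
  funext t
  have feedforward_zero : (LDC.static K).D - K = 0 := sub_self K
  have readout_zero : (LDC.static K).C = 0 := rfl
  rw [ldcEx, feedforward_zero, readout_zero, zero_mulVec, zero_mulVec, add_zero, Pi.zero_apply]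

lemma natIterate_eq_pair (P : Plant dx du dy) (K : Matrix (Fin du) (Fin dy) ℝ) (t : ℕ) :
    natIterate P K t = pair (natY P K t) (K *ᵥ natY P K t) := by
  rw [natIterate, ldcIterate_eq_drivenIterate P K, drivenIterate, ldcEx_static, Pi.zero_apply,
    add_zero, natY]

lemma l2norm_natY_le (P : Plant dx du dy) (K : Matrix (Fin du) (Fin dy) ℝ) (t : ℕ) :
    l2norm (natY P K t) ≤ ‖natIterate P K t‖ := by
  rw [natIterate_eq_pair]
  exact l2norm_comp_inl_le (Sum.elim (natY P K t) (K *ᵥ natY P K t))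

theorem IsDriven.iterate_eq {x : ℕ → Vec dx} {u : ℕ → Vec du} (hx : IsDriven P K x u) (t : ℕ) :
    drivenIterate P K x u t =
      natIterate P K t + WithLp.toLp 2 (conv (markovK P K) u t) := by
  have superposition := hx.iterate_sub_iterate (isDriven_ldcX P K (LDC.static K)) t
  rw [← ldcIterate_eq_drivenIterate, ldcEx_static, sub_zero] at superposition
  rw [natIterate, ← superposition, add_sub_cancel]

lemma IsDriven.output_sub_sum_eq_natY {x : ℕ → Vec dx} {u : ℕ → Vec du}
    (hx : IsDriven P K x u) (t : ℕ) :
    P.output x t - ∑ i ∈ Finset.range t, toRows₁ (markovK P K (t - i)) *ᵥ u i = natY P K t := by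
  have iterate_eq := congrArg (fun v : Sig dy du => fun a => v (Sum.inl a)) (hx.iterate_eq t)
  rw [natIterate_eq_pair, conv_eq_sum_reflect, Finset.sum_range_succ] at iterate_eq
  rw [sub_eq_iff_eq_add]
  refine iterate_eq.trans ?_
  funext a
  simp [pair, markovK, toRows₁, mulVec, Finset.sum_apply]

/-! ### Disturbance response of linear dynamic controllers -/

/-- The Markov parameters from nature's outputs `y^K` to the exogenous inputs `u - K y` of the
linear dynamic controller `π`. -/
def responseMat (P : Plant dx du dy) (K : Matrix (Fin du) (Fin dy) ℝ) (π : LDC du dy) :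
    ℕ → Matrix (Fin du) (Fin dy) ℝ :=
  markovParam (fromBlocks (P.A + P.B * π.D * P.C) (P.B * π.C) (π.B * P.C) π.A)
    (fromRows (P.B * (π.D - K)) π.B) (fromCols ((π.D - K) * P.C) π.C) (π.D - K)

lemma output_eq_mulVec_add_natY (P : Plant dx du dy) (K : Matrix (Fin du) (Fin dy) ℝ)
    (x : ℕ → Vec dx) (t : ℕ) :
    P.output x t = P.C *ᵥ (x - ldcX P (LDC.static K)) t + natY P K t := by
  rw [natY, Plant.output, Plant.output, Pi.sub_apply, mulVec_sub]
  abel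

theorem ldcEx_eq_conv (P : Plant dx du dy) (K : Matrix (Fin du) (Fin dy) ℝ) (π : LDC du dy)
    (t : ℕ) : ldcEx P K π t = conv (responseMat P K π) (natY P K) t := by
  set ξ : ℕ → Fin dx ⊕ Fin π.dim → ℝ := fun t =>
    Sum.elim ((ldcX P π - ldcX P (LDC.static K)) t) (ldcState P π t).2 with ξ_def
  have ξ_zero : ξ 0 = 0 := by
    simp only [ξ_def, Pi.sub_apply, ldcX, ldcState, sub_self]
    exact Sum.elim_zero_zero
  have ξ_succ (t : ℕ) : ξ (t + 1) =
      fromBlocks (P.A + P.B * π.D * P.C) (P.B * π.C) (π.B * P.C) π.A *ᵥ ξ t +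
        fromRows (P.B * (π.D - K)) π.B *ᵥ natY P K t := by
    have internal_succ : (ldcState P π (t + 1)).2 =
        π.A *ᵥ (ldcState P π t).2 + π.B *ᵥ P.output (ldcX P π) t := rfl
    have deviation_succ := (isDriven_ldcX P K π).sub_succ (isDriven_ldcX P K (LDC.static K)) t
    rw [ldcEx_static, sub_zero, ldcEx, output_eq_mulVec_add_natY P K] at deviation_succ
    simp only [ξ_def, fromBlocks_mulVec, fromRows_mulVec, Sum.elim_comp_inl, Sum.elim_comp_inr,
      ← Sum.elim_add_add]
    rw [deviation_succ, internal_succ, output_eq_mulVec_add_natY P K]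
    simp only [add_mulVec, sub_mulVec, mulVec_add, mulVec_sub, ← mulVec_mulVec]
    congr 1 <;> abel
  rw [responseMat, ← mulVec_add_eq_conv_markovParam ξ_zero ξ_succ, fromCols_mulVec_sumElim, ldcEx,
    output_eq_mulVec_add_natY P K, mulVec_add, mulVec_mulVec]
  abel

lemma responseMat_succ (P : Plant dx du dy) (K : Matrix (Fin du) (Fin dy) ℝ) (π : LDC du dy)
    (i : ℕ) : responseMat P K π (i + 1) = markovCl P K π (i + 1) *
      (fromRows 1 K : Matrix (Fin dy ⊕ Fin du) (Fin dy) ℝ) := by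
  have input_eq : fromRows (P.B * (π.D - K)) π.B =
      fromBlocks (P.B * π.D) (-P.B) π.B 0 *
        (fromRows 1 K : Matrix (Fin dy ⊕ Fin du) (Fin dy) ℝ) := by
    rw [fromBlocks_mul_fromRows, Matrix.mul_one, Matrix.mul_one, Matrix.zero_mul, add_zero,
      Matrix.neg_mul, Matrix.mul_sub, sub_eq_add_neg]
  rw [responseMat, markovParam, markovCl, input_eq, ← Matrix.mul_assoc]

lemma opNorm_feedthrough_le (P : Plant dx du dy) (K : Matrix (Fin du) (Fin dy) ℝ)
    (π : LDC du dy) : opNorm π.D ≤ opNorm (markovCl P K π 0) := by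
  refine opNorm_le_of_forall_l2norm_mulVec_le (opNorm_nonneg _) fun y => ?_
  have feedthrough_eq : markovCl P K π 0 *ᵥ Sum.elim y 0 = π.D *ᵥ y := by
    rw [markovCl, fromCols_mulVec_sumElim, mulVec_zero, add_zero]
  rw [← feedthrough_eq, ← l2norm_sumElim_zero (κ := Fin du) y]
  exact l2norm_mulVec_le _ _

lemma opNorm_responseMat_le {c ρ : ℝ} (hc : 1 ≤ c) {π : LDC du dy} (hπ : π ∈ stabClass P K c ρ)
    (i : ℕ) : opNorm (responseMat P K π i) ≤ (1 + opNorm K) * c * ρ ^ i := by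
  cases i with
  | zero =>
    have K_le : opNorm K ≤ opNorm K * c := le_mul_of_one_le_right (opNorm_nonneg K) hc
    have D_le := (opNorm_feedthrough_le P K π).trans (hπ 0)
    have sub_le := opNorm_sub_le π.D K
    rw [responseMat, markovParam]
    linarith
  | succ i =>
    calc opNorm (responseMat P K π (i + 1))
        ≤ opNorm (markovCl P K π (i + 1)) *
          opNorm (fromRows 1 K : Matrix (Fin dy ⊕ Fin du) (Fin dy) ℝ) := by
          rw [responseMat_succ]
          exact opNorm_mul_le _ _
      _ ≤ c * ρ ^ (i + 1) * (1 + opNorm K) :=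
          mul_le_mul (hπ _) (opNorm_fromRows_one_le K) (opNorm_nonneg _)
            ((opNorm_nonneg _).trans (hπ _))
      _ = (1 + opNorm K) * c * ρ ^ (i + 1) := by ring

end Dynamics

/-! ### Disturbance-response parameters -/

section Features

variable {du dy m : ℕ}

lemma embedY_congr {ω ω' : ℕ → Vec dy} {t : ℕ} (eq_of_le : ∀ s ≤ t, ω s = ω' s) :
    embedY m du ω t = embedY m du ω' t := by
  ext a j
  simp only [embedY, of_apply, eq_of_le _ (Nat.sub_le t j.1)]

lemma featH_congr {h : ℕ} {G : ℕ → Matrix (Fin dy ⊕ Fin du) (Fin du) ℝ} {ω ω' : ℕ → Vec dy}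
    {t : ℕ} (eq_of_le : ∀ s ≤ t, ω s = ω' s) : featH h m G ω t = featH h m G ω' t := by
  refine Finset.sum_congr rfl fun i _ => ?_
  rw [embedY_congr fun s hs => eq_of_le s (hs.trans (Nat.sub_le t i))]

lemma embedY_mulVec (ω : ℕ → Vec dy) (t : ℕ) (z : Param m du dy) :
    embedY m du ω t *ᵥ z.ofLp =
      ∑ i : Fin m, if (i : ℕ) ≤ t then z.mat i *ᵥ ω (t - i) else 0 := by
  funext a
  simp only [mulVec, dotProduct, embedY, of_apply, Fintype.sum_prod_type, Finset.sum_apply]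
  refine Finset.sum_congr rfl fun i _ => ?_
  rw [Finset.sum_eq_single a]
  · by_cases h : (i : ℕ) ≤ t <;> simp [h, Param.mat, mulVec, dotProduct, mul_comm]
  · intro b _ hb
    simp [hb.symm]
  · simp

/-- The parameter listing the first `m` Markov parameters `G_0, …, G_{m-1}`. -/
def Param.ofMarkov (m : ℕ) (G : ℕ → Matrix (Fin du) (Fin dy) ℝ) : Param m du dy :=
  WithLp.toLp 2 fun j => G j.1 j.2.1 j.2.2

lemma Param.mat_ofMarkov (G : ℕ → Matrix (Fin du) (Fin dy) ℝ) (i : Fin m) :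
    (Param.ofMarkov m G).mat i = G i := rfl

lemma embedY_mulVec_ofMarkov (G : ℕ → Matrix (Fin du) (Fin dy) ℝ) (ω : ℕ → Vec dy) (t : ℕ) :
    embedY m du ω t *ᵥ (Param.ofMarkov m G).ofLp = conv (truncate m G) ω t := by
  simp only [embedY_mulVec, Param.mat_ofMarkov, conv_truncate, Finset.sum_range]

lemma featH_mulVec (h : ℕ) (G : ℕ → Matrix (Fin dy ⊕ Fin du) (Fin du) ℝ) (ω : ℕ → Vec dy)
    (x : Fin m × Fin du × Fin dy → ℝ) (t : ℕ) : featH h m G ω t *ᵥ x =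
      conv (truncate (h + 1) G) (fun s => embedY m du ω s *ᵥ x) t := by
  rw [conv_truncate, featH, sum_mulVec]
  refine Finset.sum_congr rfl fun i _ => ?_
  split_ifs
  · rw [mulVec_mulVec]
  · rw [zero_mulVec]

variable {R : ℝ}

lemma Param.norm_sq_le (z : Param m du dy) :
    ‖z‖ ^ 2 ≤ du * dy * (∑ i, opNorm (z.mat i)) ^ 2 := by
  have block_le (i : Fin m) : ∑ p : Fin du × Fin dy, z (i, p) ^ 2 ≤
      du * dy * opNorm (z.mat i) ^ 2 := by
    refine (Finset.sum_le_card_nsmul _ _ (opNorm (z.mat i) ^ 2) fun p _ => ?_).trans_eq (by simp)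
    rw [← sq_abs]
    exact pow_le_pow_left₀ (abs_nonneg _) (abs_entry_le_opNorm (z.mat i) p.1 p.2) 2
  calc ‖z‖ ^ 2 = ∑ i, ∑ p : Fin du × Fin dy, z (i, p) ^ 2 := by
        rw [EuclideanSpace.real_norm_sq_eq, Fintype.sum_prod_type]
    _ ≤ ∑ i, du * dy * opNorm (z.mat i) ^ 2 := Finset.sum_le_sum fun i _ => block_le i
    _ = du * dy * ∑ i, opNorm (z.mat i) ^ 2 := by rw [Finset.mul_sum]
    _ ≤ du * dy * (∑ i, opNorm (z.mat i)) ^ 2 := by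
        gcongr
        exact Finset.sum_sq_le_sq_sum_of_nonneg fun i _ => opNorm_nonneg _

lemma norm_sq_le_of_mem_drcSet {z : Param m du dy} (hz : z ∈ drcSet m du dy R) :
    ‖z‖ ^ 2 ≤ du * dy * R ^ 2 := by
  refine z.norm_sq_le.trans ?_
  gcongr
  exacts [Finset.sum_nonneg fun i _ => opNorm_nonneg _, hz]

lemma nonneg_of_mem_drcSet {z : Param m du dy} (hz : z ∈ drcSet m du dy R) : 0 ≤ R :=
  (Finset.sum_nonneg fun _ _ => opNorm_nonneg _).trans hz

lemma norm_sub_sq_le_of_mem_drcSet {z w : Param m du dy} (hz : z ∈ drcSet m du dy R)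
    (hw : w ∈ drcSet m du dy R) : ‖z - w‖ ^ 2 ≤ 4 * (du * dy * R ^ 2) := by
  linarith [parallelogram_law_with_norm ℝ z w, sq_nonneg ‖z + w‖, norm_sq_le_of_mem_drcSet hz,
    norm_sq_le_of_mem_drcSet hw]

lemma isCompact_drcSet (m du dy : ℕ) (R : ℝ) : IsCompact (drcSet m du dy R) := by
  refine Metric.isCompact_of_isClosed_isBounded ?_ ?_
  · refine isClosed_le (continuous_finsetSum _ fun i _ => continuous_opNorm.comp ?_)
      continuous_const
    refine continuous_matrix fun a b => ?_
    simp only [Param.mat, of_apply]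
    fun_prop
  · refine (Metric.isBounded_closedBall (x := 0) (r := √(du * dy * R ^ 2))).subset fun z hz => ?_
    rw [mem_closedBall_zero_iff]
    exact Real.le_sqrt_of_sq_le (norm_sq_le_of_mem_drcSet hz)

lemma convex_drcSet (m du dy : ℕ) (R : ℝ) : Convex ℝ (drcSet m du dy R) := by
  intro z hz w hw a b ha hb hab
  have combo_le (i : Fin m) : opNorm (Param.mat (a • z + b • w) i) ≤
      a * opNorm (z.mat i) + b * opNorm (w.mat i) :=
    convexOn_opNorm.2 (Set.mem_univ (z.mat i)) (Set.mem_univ (w.mat i)) ha hb hab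
  calc ∑ i, opNorm (Param.mat (a • z + b • w) i)
      ≤ ∑ i, (a * opNorm (z.mat i) + b * opNorm (w.mat i)) :=
        Finset.sum_le_sum fun i _ => combo_le i
    _ = a * ∑ i, opNorm (z.mat i) + b * ∑ i, opNorm (w.mat i) := by
        rw [Finset.sum_add_distrib, Finset.mul_sum, Finset.mul_sum]
    _ ≤ a * R + b * R := by gcongr <;> assumption
    _ = R := by rw [← add_mul, hab, one_mul]

lemma ofMarkov_mem_drcSet {G : ℕ → Matrix (Fin du) (Fin dy) ℝ} {c ρ : ℝ} (hc : 0 ≤ c)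
    (hρ : 0 ≤ ρ) (hρ1 : ρ < 1) (hG : ∀ i, opNorm (G i) ≤ c * ρ ^ i) :
    Param.ofMarkov m G ∈ drcSet m du dy (c / (1 - ρ)) := by
  change ∑ i : Fin m, opNorm (G i) ≤ c / (1 - ρ)
  calc ∑ i : Fin m, opNorm (G i) ≤ ∑ i : Fin m, c * ρ ^ (i : ℕ) :=
        Finset.sum_le_sum fun i _ => hG i
    _ = c * ∑ i ∈ Finset.range m, ρ ^ i := by rw [← Finset.mul_sum, Finset.sum_range]
    _ ≤ c / (1 - ρ) := by
        rw [div_eq_mul_one_div]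
        exact mul_le_mul_of_nonneg_left (sum_range_pow_le hρ hρ1 m) hc

lemma ofMarkov_responseMat_mem_drcSet {dx : ℕ} {P : Plant dx du dy}
    {K : Matrix (Fin du) (Fin dy) ℝ} {c ρ : ℝ} (hc : 1 ≤ c) (hρ : 0 ≤ ρ) (hρ1 : ρ < 1)
    {π : LDC du dy} (hπ : π ∈ stabClass P K c ρ) :
    Param.ofMarkov m (responseMat P K π) ∈ drcSet m du dy ((1 + opNorm K) * c / (1 - ρ)) :=
  ofMarkov_mem_drcSet
    (mul_nonneg (add_nonneg zero_le_one (opNorm_nonneg K)) (zero_le_one.trans hc)) hρ hρ1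
    (opNorm_responseMat_le hc hπ)

variable {ω : ℕ → Vec dy} {r : ℝ}

lemma l2norm_embedY_mulVec_le (hω : ∀ s, l2norm (ω s) ≤ r) {z : Param m du dy}
    (hz : z ∈ drcSet m du dy R) (t : ℕ) : l2norm (embedY m du ω t *ᵥ z.ofLp) ≤ R * r := by
  have r_nonneg : 0 ≤ r := (l2norm_nonneg _).trans (hω 0)
  have term_le (i : Fin m) : l2norm (if (i : ℕ) ≤ t then z.mat i *ᵥ ω (t - i) else 0) ≤
      opNorm (z.mat i) * r := by
    split_ifs
    · exact (l2norm_mulVec_le _ _).trans (mul_le_mul_of_nonneg_left (hω _) (opNorm_nonneg _))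
    · rw [l2norm_zero]
      exact mul_nonneg (opNorm_nonneg _) r_nonneg
  rw [embedY_mulVec]
  calc _ ≤ ∑ i, opNorm (z.mat i) * r :=
        (l2norm_sum_le _ _).trans (Finset.sum_le_sum fun i _ => term_le i)
    _ = (∑ i, opNorm (z.mat i)) * r := by rw [Finset.sum_mul]
    _ ≤ R * r := mul_le_mul_of_nonneg_right hz r_nonneg

lemma l2norm_embedY_mulVec_single_le (hω : ∀ s, l2norm (ω s) ≤ r) (t : ℕ)
    (j : Fin m × Fin du × Fin dy) : l2norm (embedY m du ω t *ᵥ Pi.single j 1) ≤ r := by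
  have r_nonneg : 0 ≤ r := (l2norm_nonneg _).trans (hω 0)
  rw [mulVec_single_one]
  by_cases hj : (j.1 : ℕ) ≤ t
  · have col_eq : (embedY m du ω t).col j = Pi.single j.2.1 (ω (t - j.1) j.2.2) := by
      funext a
      simp [embedY, hj, Pi.single_apply]
    rw [col_eq, l2norm, PiLp.toLp_single, PiLp.norm_single]
    exact (abs_le_l2norm _ _).trans (hω _)
  · have col_eq : (embedY m du ω t).col j = 0 := by
      funext a
      simp [embedY, hj]
    rw [col_eq, l2norm_zero]
    exact r_nonneg

lemma trace_transpose_mul_self_le {ι κ : Type*} [Fintype ι] [Fintype κ] [DecidableEq ι]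
    {M : Matrix κ ι ℝ} {b : ℝ} (col_le : ∀ j, l2norm (M *ᵥ Pi.single j 1) ≤ b) :
    (Mᵀ * M).trace ≤ b ^ 2 * Fintype.card ι := by
  have diag_eq (j : ι) : (Mᵀ * M) j j = l2norm (M *ᵥ Pi.single j 1) ^ 2 := by
    rw [l2norm_sq_eq_dotProduct, mulVec_single_one, mul_apply]
    rfl
  simp only [trace, diag, diag_eq]
  refine (Finset.sum_le_card_nsmul _ _ (b ^ 2) fun j _ => ?_).trans_eq
    (by rw [nsmul_eq_mul, mul_comm, Finset.card_univ])
  exact pow_le_pow_left₀ (l2norm_nonneg _) (col_le j) 2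

variable {h : ℕ} {G : ℕ → Matrix (Fin dy ⊕ Fin du) (Fin du) ℝ} {c ρ : ℝ}

lemma l2norm_featH_mulVec_le (hc : 0 ≤ c) (hρ : 0 ≤ ρ) (hρ1 : ρ < 1)
    (hG : ∀ n, opNorm (G n) ≤ c * ρ ^ n) {x : Fin m × Fin du × Fin dy → ℝ}
    (hx : ∀ s, l2norm (embedY m du ω s *ᵥ x) ≤ r) (t : ℕ) :
    l2norm (featH h m G ω t *ᵥ x) ≤ c / (1 - ρ) * r := by
  rw [featH_mulVec]
  exact l2norm_conv_le_of_geometric hc hρ hρ1 (opNorm_truncate_le hc hρ hG _) hx t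

lemma trace_featH_le (hc : 0 ≤ c) (hρ : 0 ≤ ρ) (hρ1 : ρ < 1)
    (hG : ∀ n, opNorm (G n) ≤ c * ρ ^ n) (hω : ∀ s, l2norm (ω s) ≤ r) (t : ℕ) :
    ((featH h m G ω t)ᵀ * featH h m G ω t).trace ≤
      (c / (1 - ρ) * r) ^ 2 * Fintype.card (Fin m × Fin du × Fin dy) :=
  trace_transpose_mul_self_le fun j => l2norm_featH_mulVec_le hc hρ hρ1 hG
    (fun s => l2norm_embedY_mulVec_single_le hω s j) t

variable {dx : ℕ}

-- `[-K  I]` recovers the exogenous input `u - K y` from `(y, u)`, so it inverts `G_K` on the left.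
lemma fromCols_neg_one_mul_markovK (P : Plant dx du dy) (K : Matrix (Fin du) (Fin dy) ℝ) (i : ℕ) :
    fromCols (-K) (1 : Matrix (Fin du) (Fin du) ℝ) * markovK P K i = if i = 0 then 1 else 0 := by
  cases i with
  | zero => simp [markovK, fromCols_mul_fromRows]
  | succ i => simp [markovK, ← Matrix.mul_assoc, fromCols_mul_fromRows]

lemma fromCols_neg_one_mulVec_featH (P : Plant dx du dy) (K : Matrix (Fin du) (Fin dy) ℝ) (h : ℕ)
    (ω : ℕ → Vec dy) (t : ℕ) (x : Fin m × Fin du × Fin dy → ℝ) :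
    fromCols (-K) (1 : Matrix (Fin du) (Fin du) ℝ) *ᵥ featH h m (markovK P K) ω t *ᵥ x =
      embedY m du ω t *ᵥ x := by
  have truncated (i : ℕ) : fromCols (-K) (1 : Matrix (Fin du) (Fin du) ℝ) *
      truncate (h + 1) (markovK P K) i = if i = 0 then 1 else 0 := by
    rw [truncate]
    split_ifs with lt eq_zero eq_zero
    · rw [fromCols_neg_one_mul_markovK, if_pos eq_zero]
    · rw [fromCols_neg_one_mul_markovK, if_neg eq_zero]
    · omega
    · rw [Matrix.mul_zero]
  rw [featH_mulVec, mulVec_conv, conv, Finset.sum_range_succ']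
  simp only [truncated, Nat.add_eq_zero_iff, one_ne_zero, and_false, if_false, if_true,
    zero_mulVec, Finset.sum_const_zero, zero_add, one_mulVec, Nat.sub_zero]

lemma l2norm_embedY_le_featH (P : Plant dx du dy) (K : Matrix (Fin du) (Fin dy) ℝ) (h : ℕ)
    (ω : ℕ → Vec dy) (t : ℕ) (x : Fin m × Fin du × Fin dy → ℝ) :
    l2norm (embedY m du ω t *ᵥ x) ≤
      (1 + opNorm K) * l2norm (featH h m (markovK P K) ω t *ᵥ x) := by
  rw [← fromCols_neg_one_mulVec_featH P K h]
  exact (l2norm_mulVec_le _ _).trans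
    (mul_le_mul_of_nonneg_right (opNorm_fromCols_neg_one_le K) (l2norm_nonneg _))

end Features

/-! ### The algorithm -/

section Algorithm

variable {dx du dy : ℕ} (P : Plant dx du dy) (K : Matrix (Fin du) (Fin dy) ℝ)
  (ℓ : ℕ → Sig dy du → ℝ) (cfg : Config) (z₁ : Param cfg.m du dy)

/-- The plant states under DRC-ONS. -/
def algX (t : ℕ) : Vec dx := (algState P K ℓ cfg z₁ t).1

/-- The parameter `z_t` of DRC-ONS. -/
def algZ (t : ℕ) : Param cfg.m du dy := (algState P K ℓ cfg z₁ t).2.z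

/-- The exogenous input `u^ex_t` played by DRC-ONS. -/
def algEx (t : ℕ) : Vec du :=
  (algState P K ℓ cfg z₁ t).2.exInput (markovK P K) t (P.output (algX P K ℓ cfg z₁) t)

/-- The features `H_t` of DRC-ONS, for the recovered outputs `y^nat = y^K`. -/
def algH (P : Plant dx du dy) (K : Matrix (Fin du) (Fin dy) ℝ) (cfg : Config) :
    ℕ → Matrix (Fin dy ⊕ Fin du) (Fin cfg.m × Fin du × Fin dy) ℝ :=
  featH cfg.h cfg.m (markovK P K) (natY P K)

/-- The iterate `(y^K_t, K y^K_t) + H_t z` at which the loss of round `t` is evaluated in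
`f_t(z)`. -/
def surrogate (P : Plant dx du dy) (K : Matrix (Fin du) (Fin dy) ℝ) (cfg : Config) (t : ℕ)
    (z : Param cfg.m du dy) : Sig dy du :=
  natIterate P K t + WithLp.toLp 2 (algH P K cfg t *ᵥ z.ofLp)

lemma isDriven_algX : IsDriven P K (algX P K ℓ cfg z₁) (algEx P K ℓ cfg z₁) where
  zero := rfl
  succ _ := rfl

lemma algIterate_eq_drivenIterate (t : ℕ) : algIterate P K ℓ cfg z₁ t =
    drivenIterate P K (algX P K ℓ cfg z₁) (algEx P K ℓ cfg z₁) t := rfl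

lemma algState_uex {s t : ℕ} (hst : s < t) :
    (algState P K ℓ cfg z₁ t).2.uex s = algEx P K ℓ cfg z₁ s := by
  induction t with
  | zero => exact absurd hst (Nat.not_lt_zero s)
  | succ t ih =>
    change Function.update (algState P K ℓ cfg z₁ t).2.uex t (algEx P K ℓ cfg z₁ t) s = _
    rcases Nat.lt_succ_iff_lt_or_eq.1 hst with hst | rfl
    · rw [Function.update_of_ne hst.ne, ih hst]
    · rw [Function.update_self]

lemma algState_recover {s t : ℕ} (hst : s ≤ t) :
    (algState P K ℓ cfg z₁ t).2.recover (markovK P K) t (P.output (algX P K ℓ cfg z₁) t) s =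
      natY P K s := by
  have recover_self (t : ℕ) : (algState P K ℓ cfg z₁ t).2.recover (markovK P K) t
      (P.output (algX P K ℓ cfg z₁) t) t = natY P K t := by
    rw [Memory.recover, Function.update_self, Finset.sum_congr rfl fun i hi => by
      rw [algState_uex P K ℓ cfg z₁ (Finset.mem_range.1 hi)]]
    exact (isDriven_algX P K ℓ cfg z₁).output_sub_sum_eq_natY t
  induction t with
  | zero =>
    obtain rfl : s = 0 := Nat.le_zero.1 hst
    exact recover_self 0
  | succ t ih =>
    rcases Nat.le_succ_iff.1 hst with hst | rfl
    · rw [Memory.recover, Function.update_of_ne (by omega)]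
      exact ih hst
    · exact recover_self (t + 1)

lemma algEx_eq (t : ℕ) : algEx P K ℓ cfg z₁ t =
    embedY cfg.m du (natY P K) t *ᵥ (algZ P K ℓ cfg z₁ t).ofLp := by
  rw [algEx, Memory.exInput, embedY_congr fun s hs => algState_recover P K ℓ cfg z₁ hs, algZ]

lemma algState_Λ (t : ℕ) :
    (algState P K ℓ cfg z₁ t).2.Λ = regGram cfg.lam (algH P K cfg) t := by
  induction t with
  | zero => exact regGram_zero.symm
  | succ t ih =>
    rw [regGram_succ, ← ih, algH, ← featH_congr fun s hs => algState_recover P K ℓ cfg z₁ hs]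
    rfl

lemma algZ_succ (t : ℕ) : algZ P K ℓ cfg z₁ (t + 1) =
    semiOnsStep (drcSet cfg.m du dy cfg.R) cfg.η (regGram cfg.lam (algH P K cfg) (t + 1))
      (fun z => ℓ t (surrogate P K cfg t z)) (algZ P K ℓ cfg z₁ t) := by
  simp only [surrogate, natIterate_eq_pair]
  rw [← algState_Λ P K ℓ cfg z₁, algH, ← featH_congr fun s hs => algState_recover P K ℓ cfg z₁ hs,
    ← algState_recover P K ℓ cfg z₁ le_rfl]
  rfl

variable {P K ℓ cfg z₁}

lemma algZ_mem (hz₁ : z₁ ∈ drcSet cfg.m du dy cfg.R) (t : ℕ) :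
    algZ P K ℓ cfg z₁ t ∈ drcSet cfg.m du dy cfg.R := by
  cases t with
  | zero => exact hz₁
  | succ t =>
    rw [algZ_succ]
    exact weightedProj_mem (isCompact_drcSet _ _ _ _) ⟨z₁, hz₁⟩ _ _

lemma surrogate_sub_surrogate (t : ℕ) (z w : Param cfg.m du dy) :
    surrogate P K cfg t z - surrogate P K cfg t w =
      WithLp.toLp 2 (algH P K cfg t *ᵥ (z - w).ofLp) := by
  rw [surrogate, surrogate, add_sub_add_left_eq_sub, ← WithLp.toLp_sub, ← mulVec_sub,
    WithLp.ofLp_sub]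

end Algorithm

/-! ### Regret against disturbance-response parameters -/

section Regret

variable {dx du dy : ℕ} {P : Plant dx du dy} {K : Matrix (Fin du) (Fin dy) ℝ}
  {ℓ : ℕ → Sig dy du → ℝ} {cfg : Config} {z₁ : Param cfg.m du dy} {L α Rnat cK ρK : ℝ}

/-- The feedback `K` is stabilizing: the iterates under `u = K y` have norm at most `Rnat`, and the
Markov operator `G_K` decays geometrically. -/
structure StableNominal (P : Plant dx du dy) (K : Matrix (Fin du) (Fin dy) ℝ)
    (Rnat cK ρK : ℝ) : Prop where
  one_le_Rnat : 1 ≤ Rnat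
  nat_le : ∀ t, ‖natIterate P K t‖ ≤ Rnat
  cK_pos : 0 < cK
  ρK_pos : 0 < ρK
  ρK_lt_one : ρK < 1
  markov_le : ∀ n : ℕ, opNorm (markovK P K n) ≤ cK * ρK ^ n

/-- How far exogenous inputs of norm at most `R * Rnat`, such as those generated by a parameter in
`drcSet m du dy R`, can move the iterates away from `v^K`. -/
def deviationBound (Rnat cK ρK R : ℝ) : ℝ := cK / (1 - ρK) * (R * Rnat)

/-- A bound on the gradients of the losses along the trajectory and along its surrogates. -/
def gradientBound (L Rnat cK ρK R : ℝ) : ℝ := L * (Rnat + deviationBound Rnat cK ρK R)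

namespace StableNominal

lemma Rnat_nonneg (A : StableNominal P K Rnat cK ρK) : 0 ≤ Rnat := zero_le_one.trans A.one_le_Rnat

lemma one_sub_ρK_pos (A : StableNominal P K Rnat cK ρK) : 0 < 1 - ρK := sub_pos.2 A.ρK_lt_one

lemma deviationBound_nonneg (A : StableNominal P K Rnat cK ρK) {R : ℝ} (hR : 0 ≤ R) :
    0 ≤ deviationBound Rnat cK ρK R :=
  mul_nonneg (div_pos A.cK_pos A.one_sub_ρK_pos).le (mul_nonneg hR A.Rnat_nonneg)

lemma l2norm_natY_le (A : StableNominal P K Rnat cK ρK) (t : ℕ) : l2norm (natY P K t) ≤ Rnat :=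
  (DrcOns.l2norm_natY_le P K t).trans (A.nat_le t)

lemma norm_drivenIterate_le (A : StableNominal P K Rnat cK ρK) {x : ℕ → Vec dx} {u : ℕ → Vec du}
    (hx : IsDriven P K x u) {R : ℝ} (hu : ∀ s, l2norm (u s) ≤ R * Rnat) (t : ℕ) :
    ‖drivenIterate P K x u t‖ ≤ Rnat + deviationBound Rnat cK ρK R := by
  rw [hx.iterate_eq]
  exact (norm_add_le _ _).trans (add_le_add (A.nat_le t)
    (l2norm_conv_le_of_geometric A.cK_pos.le A.ρK_pos.le A.ρK_lt_one A.markov_le hu t))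

lemma norm_surrogate_le (A : StableNominal P K Rnat cK ρK) {z : Param cfg.m du dy}
    (hz : z ∈ drcSet cfg.m du dy cfg.R) (t : ℕ) :
    ‖surrogate P K cfg t z‖ ≤ Rnat + deviationBound Rnat cK ρK cfg.R :=
  (norm_add_le _ _).trans (add_le_add (A.nat_le t)
    (l2norm_featH_mulVec_le A.cK_pos.le A.ρK_pos.le A.ρK_lt_one A.markov_le
      (l2norm_embedY_mulVec_le A.l2norm_natY_le hz) t))

lemma norm_drivenIterate_sub_surrogate_le (A : StableNominal P K Rnat cK ρK) {x : ℕ → Vec dx}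
    {u : ℕ → Vec du} (hx : IsDriven P K x u) {R : ℝ} (hR : 0 ≤ R)
    (hu : ∀ s, l2norm (u s) ≤ R * Rnat) (z : Param cfg.m du dy) (t : ℕ) :
    ‖drivenIterate P K x u t - surrogate P K cfg t z‖ ≤
      deviationBound Rnat cK ρK R * ρK ^ cfg.h +
        l2norm (conv (truncate (cfg.h + 1) (markovK P K))
          (u - fun s => embedY cfg.m du (natY P K) s *ᵥ z.ofLp) t) := by
  have difference_eq : drivenIterate P K x u t - surrogate P K cfg t z =
      WithLp.toLp 2 (conv (markovK P K) u t - conv (truncate (cfg.h + 1) (markovK P K)) u t +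
        conv (truncate (cfg.h + 1) (markovK P K))
          (u - fun s => embedY cfg.m du (natY P K) s *ᵥ z.ofLp) t) := by
    rw [hx.iterate_eq, surrogate, add_sub_add_left_eq_sub, ← WithLp.toLp_sub, algH, featH_mulVec,
      conv_sub_right, sub_add_sub_cancel]
  rw [difference_eq]
  refine (l2norm_add_le _ _).trans (add_le_add_left ?_ _)
  calc l2norm (conv (markovK P K) u t - conv (truncate (cfg.h + 1) (markovK P K)) u t)
      ≤ deviationBound Rnat cK ρK R * ρK ^ (cfg.h + 1) :=
        l2norm_conv_sub_conv_truncate_le A.cK_pos.le A.ρK_pos.le A.ρK_lt_one A.markov_le hu _ t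
    _ ≤ deviationBound Rnat cK ρK R * ρK ^ cfg.h :=
        mul_le_mul_of_nonneg_left
          (pow_le_pow_of_le_one A.ρK_pos.le A.ρK_lt_one.le (Nat.le_succ _))
          (A.deviationBound_nonneg hR)

variable {cs ρs : ℝ} {π : LDC du dy}

lemma norm_ldcIterate_sub_surrogate_le (A : StableNominal P K Rnat cK ρK) (hcs : 1 ≤ cs)
    (hρs : 0 ≤ ρs) (hρs1 : ρs < 1) (hπ : π ∈ stabClass P K cs ρs)
    (hR : cfg.R = (1 + opNorm K) * cs / (1 - ρs)) (t : ℕ) :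
    ‖ldcIterate P π t - surrogate P K cfg t (Param.ofMarkov cfg.m (responseMat P K π))‖ ≤
      deviationBound Rnat cK ρK cfg.R * (ρs ^ cfg.m + ρK ^ cfg.h) := by
  have const_nonneg : 0 ≤ (1 + opNorm K) * cs :=
    mul_nonneg (add_nonneg zero_le_one (opNorm_nonneg K)) (zero_le_one.trans hcs)
  have R_nonneg : 0 ≤ cfg.R := hR ▸ div_nonneg const_nonneg (sub_pos.2 hρs1).le
  have response_le := opNorm_responseMat_le hcs hπ
  have input_le (s : ℕ) : l2norm (ldcEx P K π s) ≤ cfg.R * Rnat := by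
    rw [ldcEx_eq_conv, hR]
    exact l2norm_conv_le_of_geometric const_nonneg hρs hρs1 response_le A.l2norm_natY_le s
  have truncated_input_le (s : ℕ) : l2norm ((ldcEx P K π - fun s => embedY cfg.m du (natY P K) s *ᵥ
      (Param.ofMarkov cfg.m (responseMat P K π)).ofLp) s) ≤ cfg.R * Rnat * ρs ^ cfg.m := by
    rw [Pi.sub_apply, ldcEx_eq_conv, embedY_mulVec_ofMarkov, hR]
    exact l2norm_conv_sub_conv_truncate_le const_nonneg hρs hρs1 response_le A.l2norm_natY_le _ s
  have response_error := l2norm_conv_le_of_geometric A.cK_pos.le A.ρK_pos.le A.ρK_lt_one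
    (opNorm_truncate_le A.cK_pos.le A.ρK_pos.le A.markov_le (cfg.h + 1)) truncated_input_le t
  rw [ldcIterate_eq_drivenIterate P K]
  refine (A.norm_drivenIterate_sub_surrogate_le (isDriven_ldcX P K π) R_nonneg input_le _ t).trans
    ((add_le_add_right response_error _).trans_eq ?_)
  rw [deviationBound]
  ring

lemma one_le_iterateBound (A : StableNominal P K Rnat cK ρK) {R : ℝ} (hR : 0 ≤ R) :
    1 ≤ Rnat + deviationBound Rnat cK ρK R :=
  le_add_of_le_of_nonneg A.one_le_Rnat (A.deviationBound_nonneg hR)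

lemma sum_surrogate_sub_ldcIterate_le (A : StableNominal P K Rnat cK ρK)
    (hℓ : ∀ t, LossRegular L α (ℓ t)) (hα : 0 ≤ α) (hcs : 1 ≤ cs) (hρs : 0 ≤ ρs) (hρs1 : ρs < 1)
    (hπ : π ∈ stabClass P K cs ρs) (hR : cfg.R = (1 + opNorm K) * cs / (1 - ρs)) (T : ℕ) :
    ∑ t ∈ Finset.range T, (ℓ t (surrogate P K cfg t (Param.ofMarkov cfg.m (responseMat P K π))) -
        ℓ t (ldcIterate P π t)) ≤
      T * (gradientBound L Rnat cK ρK cfg.R *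
        (deviationBound Rnat cK ρK cfg.R * (ρs ^ cfg.m + ρK ^ cfg.h))) := by
  have q_mem := ofMarkov_responseMat_mem_drcSet (m := cfg.m) hcs hρs hρs1 hπ
  rw [← hR] at q_mem
  have bound_ge_one := A.one_le_iterateBound (nonneg_of_mem_drcSet q_mem)
  have bound_nonneg := mul_nonneg (hℓ 0).const_nonneg (zero_le_one.trans bound_ge_one)
  refine (Finset.sum_le_sum (g := fun _ => gradientBound L Rnat cK ρK cfg.R *
    (deviationBound Rnat cK ρK cfg.R * (ρs ^ cfg.m + ρK ^ cfg.h))) fun t _ => ?_).trans_eq ?_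
  · refine ((hℓ t).sub_le hα bound_ge_one (A.norm_surrogate_le q_mem t)).trans
      (mul_le_mul_of_nonneg_left ?_ bound_nonneg)
    rw [norm_sub_rev]
    exact A.norm_ldcIterate_sub_surrogate_le hcs hρs hρs1 hπ hR t
  · rw [Finset.sum_const, Finset.card_range, nsmul_eq_mul]

end StableNominal

/-- DRC-ONS is run with the step size `1 / α` matching the curvature of the losses and with a
regularizer dominating the squared columns of the features `H_t`. -/
structure TunedRun (P : Plant dx du dy) (K : Matrix (Fin du) (Fin dy) ℝ)
    (ℓ : ℕ → Sig dy du → ℝ) (cfg : Config) (z₁ : Param cfg.m du dy) (L α Rnat cK ρK : ℝ) : Prop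
    extends StableNominal P K Rnat cK ρK where
  lossRegular : ∀ t, LossRegular L α (ℓ t)
  α_pos : 0 < α
  η_eq : cfg.η = 1 / α
  le_lam : (cK / (1 - ρK) * Rnat) ^ 2 ≤ cfg.lam
  mem : z₁ ∈ drcSet cfg.m du dy cfg.R

namespace TunedRun

lemma R_nonneg (A : TunedRun P K ℓ cfg z₁ L α Rnat cK ρK) : 0 ≤ cfg.R := nonneg_of_mem_drcSet A.mem

lemma lam_pos (A : TunedRun P K ℓ cfg z₁ L α Rnat cK ρK) : 0 < cfg.lam := by
  have := mul_pos (div_pos A.cK_pos A.one_sub_ρK_pos) (zero_lt_one.trans_le A.one_le_Rnat)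
  exact (pow_pos this 2).trans_le A.le_lam

lemma gradientBound_nonneg (A : TunedRun P K ℓ cfg z₁ L α Rnat cK ρK) :
    0 ≤ gradientBound L Rnat cK ρK cfg.R :=
  mul_nonneg (A.lossRegular 0).const_nonneg
    (zero_le_one.trans (A.one_le_iterateBound A.R_nonneg))

lemma l2norm_algEx_le (A : TunedRun P K ℓ cfg z₁ L α Rnat cK ρK) (t : ℕ) :
    l2norm (algEx P K ℓ cfg z₁ t) ≤ cfg.R * Rnat := by
  rw [algEx_eq]
  exact l2norm_embedY_mulVec_le A.l2norm_natY_le (algZ_mem A.mem t) t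

lemma newtonIterates (A : TunedRun P K ℓ cfg z₁ L α Rnat cK ρK) :
    NewtonIterates (drcSet cfg.m du dy cfg.R) (1 / α) cfg.lam (gradientBound L Rnat cK ρK cfg.R)
      (algH P K cfg)
      (fun t => (gradient (ℓ t) (surrogate P K cfg t (algZ P K ℓ cfg z₁ t))).ofLp)
      (algZ P K ℓ cfg z₁) where
  compact := isCompact_drcSet _ _ _ _
  convex := convex_drcSet _ _ _ _
  η_pos := one_div_pos.2 A.α_pos
  lam_pos := A.lam_pos
  mem := algZ_mem A.mem
  succ t := by
    simp only [algZ_succ, semiOnsStep, surrogate, A.η_eq,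
      gradient_comp_const_add_mulVec (A.lossRegular t).differentiable.differentiableAt]
  l2norm_le t := ((A.lossRegular t).gradient_le _).trans (mul_le_mul_of_nonneg_left
    (max_le (A.one_le_iterateBound A.R_nonneg) (A.norm_surrogate_le (algZ_mem A.mem t) t))
    (A.lossRegular t).const_nonneg)

/-- The leverage `tr (H_t Λ_t⁻¹ H_tᵀ)` of round `t`. -/
abbrev lev (P : Plant dx du dy) (K : Matrix (Fin du) (Fin dy) ℝ) (cfg : Config) (t : ℕ) : ℝ :=
  roundLeverage cfg.lam (algH P K cfg) t

-- `y^nat` enters `H_s` only through `Y_s`, which `[-K  I]` recovers from `H_s`; so parameters that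
-- are close in the geometry of `H_s` generate close inputs.
lemma l2norm_algEx_sub_embedY_le (A : TunedRun P K ℓ cfg z₁ L α Rnat cK ρK) (s i : ℕ) :
    l2norm (algEx P K ℓ cfg z₁ s -
        embedY cfg.m du (natY P K) s *ᵥ (algZ P K ℓ cfg z₁ (s + i)).ofLp) ≤
      (1 + opNorm K) * (1 / α * gradientBound L Rnat cK ρK cfg.R / 2 *
        ∑ k ∈ Finset.range i, (lev P K cfg s + lev P K cfg (s + k))) := by
  rw [algEx_eq, l2norm_sub_rev, ← mulVec_sub, ← WithLp.ofLp_sub]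
  exact (l2norm_embedY_le_featH P K cfg.h _ _ _).trans (mul_le_mul_of_nonneg_left
    (A.newtonIterates.l2norm_mulVec_add_sub_le s i) (add_nonneg zero_le_one (opNorm_nonneg K)))

lemma l2norm_conv_drift_le (A : TunedRun P K ℓ cfg z₁ L α Rnat cK ρK) (t : ℕ) :
    l2norm (conv (truncate (cfg.h + 1) (markovK P K)) (algEx P K ℓ cfg z₁ -
        fun s => embedY cfg.m du (natY P K) s *ᵥ (algZ P K ℓ cfg z₁ t).ofLp) t) ≤
      (1 + opNorm K) * cK * (1 / α * gradientBound L Rnat cK ρK cfg.R / 2) *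
        ∑ i ∈ Finset.range (t + 1), ρK ^ i *
          ∑ k ∈ Finset.range i, (lev P K cfg (t - i) + lev P K cfg (t - i + k)) := by
  rw [conv, Finset.mul_sum]
  refine (l2norm_sum_le _ _).trans (Finset.sum_le_sum fun i hi => ?_)
  have drift_le := A.l2norm_algEx_sub_embedY_le (t - i) i
  rw [Nat.sub_add_cancel (Nat.lt_succ_iff.1 (Finset.mem_range.1 hi))] at drift_le
  refine (l2norm_mulVec_le _ _).trans ((mul_le_mul
    (opNorm_truncate_le A.cK_pos.le A.ρK_pos.le A.markov_le _ i) drift_le (l2norm_nonneg _)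
    (mul_pos A.cK_pos (pow_pos A.ρK_pos i)).le).trans_eq ?_)
  ring

lemma loss_sub_surrogate_le (A : TunedRun P K ℓ cfg z₁ L α Rnat cK ρK) (t : ℕ) :
    ℓ t (algIterate P K ℓ cfg z₁ t) - ℓ t (surrogate P K cfg t (algZ P K ℓ cfg z₁ t)) ≤
      gradientBound L Rnat cK ρK cfg.R * (deviationBound Rnat cK ρK cfg.R * ρK ^ cfg.h +
        (1 + opNorm K) * cK * (1 / α * gradientBound L Rnat cK ρK cfg.R / 2) *
          ∑ i ∈ Finset.range (t + 1), ρK ^ i *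
            ∑ k ∈ Finset.range i, (lev P K cfg (t - i) + lev P K cfg (t - i + k))) := by
  have driven := isDriven_algX P K ℓ cfg z₁
  rw [algIterate_eq_drivenIterate]
  exact ((A.lossRegular t).sub_le A.α_pos.le (A.one_le_iterateBound A.R_nonneg)
    (A.norm_drivenIterate_le driven A.l2norm_algEx_le t)).trans
    (mul_le_mul_of_nonneg_left ((A.norm_drivenIterate_sub_surrogate_le driven A.R_nonneg
      A.l2norm_algEx_le _ t).trans (add_le_add_right (A.l2norm_conv_drift_le t) _))
      A.gradientBound_nonneg)

theorem sum_loss_sub_surrogate_le (A : TunedRun P K ℓ cfg z₁ L α Rnat cK ρK) (T : ℕ) :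
    ∑ t ∈ Finset.range T,
        (ℓ t (algIterate P K ℓ cfg z₁ t) - ℓ t (surrogate P K cfg t (algZ P K ℓ cfg z₁ t))) ≤
      T * (gradientBound L Rnat cK ρK cfg.R * (deviationBound Rnat cK ρK cfg.R * ρK ^ cfg.h)) +
        gradientBound L Rnat cK ρK cfg.R ^ 2 / α * ((1 + opNorm K) * cK / (1 - ρK) ^ 2) *
          ∑ t ∈ Finset.range T, lev P K cfg t := by
  have lev_nonneg := roundLeverage_nonneg A.lam_pos (algH P K cfg)
  have one_sub_pos := A.one_sub_ρK_pos
  have γ_nonneg := A.gradientBound_nonneg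
  have cK_pos := A.cK_pos
  have α_pos := A.α_pos
  have K_nonneg := opNorm_nonneg K
  set γ := gradientBound L Rnat cK ρK cfg.R
  have delayed_sum_le : ∑ t ∈ Finset.range T, ∑ i ∈ Finset.range (t + 1), ρK ^ i *
      ∑ k ∈ Finset.range i, (lev P K cfg (t - i) + lev P K cfg (t - i + k)) ≤
      1 / (1 - ρK) ^ 2 * (2 * ∑ t ∈ Finset.range T, lev P K cfg t) :=
    (sum_range_sum_delayed_le lev_nonneg (fun i => pow_nonneg A.ρK_pos.le i) T).trans
      (mul_le_mul_of_nonneg_right (sum_range_natCast_mul_pow_le A.ρK_pos.le A.ρK_lt_one T)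
        (mul_nonneg zero_le_two (Finset.sum_nonneg fun t _ => lev_nonneg t)))
  refine (Finset.sum_le_sum fun t _ => A.loss_sub_surrogate_le t).trans ?_
  rw [← Finset.mul_sum, Finset.sum_add_distrib, Finset.sum_const, Finset.card_range, nsmul_eq_mul,
    ← Finset.mul_sum]
  calc _ ≤ γ * (T * (deviationBound Rnat cK ρK cfg.R * ρK ^ cfg.h) +
        (1 + opNorm K) * cK * (1 / α * γ / 2) *
          (1 / (1 - ρK) ^ 2 * (2 * ∑ t ∈ Finset.range T, lev P K cfg t))) := by gcongr
    _ = _ := by field_simp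

lemma surrogate_sub_surrogate_le (A : TunedRun P K ℓ cfg z₁ L α Rnat cK ρK)
    (q : Param cfg.m du dy) (t : ℕ) :
    ℓ t (surrogate P K cfg t (algZ P K ℓ cfg z₁ t)) - ℓ t (surrogate P K cfg t q) ≤
      (gradient (ℓ t) (surrogate P K cfg t (algZ P K ℓ cfg z₁ t))).ofLp ⬝ᵥ
          algH P K cfg t *ᵥ (algZ P K ℓ cfg z₁ t - q).ofLp -
        1 / (2 * (1 / α)) * l2norm (algH P K cfg t *ᵥ (algZ P K ℓ cfg z₁ t - q).ofLp) ^ 2 := by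
  have first_order := (A.lossRegular t).add_inner_gradient_le
    (surrogate P K cfg t (algZ P K ℓ cfg z₁ t)) (surrogate P K cfg t q)
  rw [← neg_sub (surrogate P K cfg t (algZ P K ℓ cfg z₁ t)), inner_neg_right, norm_neg,
    surrogate_sub_surrogate, inner_eq_dotProduct] at first_order
  have half_α : 1 / (2 * (1 / α)) = α / 2 := by rw [mul_one_div, one_div_div]
  rw [half_α, l2norm]
  linarith

theorem sum_surrogate_sub_le (A : TunedRun P K ℓ cfg z₁ L α Rnat cK ρK) {q : Param cfg.m du dy}
    (hq : q ∈ drcSet cfg.m du dy cfg.R) (T : ℕ) :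
    ∑ t ∈ Finset.range T,
        (ℓ t (surrogate P K cfg t (algZ P K ℓ cfg z₁ t)) - ℓ t (surrogate P K cfg t q)) ≤
      2 * α * cfg.lam * (du * dy * cfg.R ^ 2) +
        gradientBound L Rnat cK ρK cfg.R ^ 2 / (2 * α) * ∑ t ∈ Finset.range T, lev P K cfg t := by
  have α_pos := A.α_pos
  have lam_pos := A.lam_pos
  have diameter_sq_le :=
    norm_sub_sq_le_of_mem_drcSet (algZ_mem (P := P) (K := K) (ℓ := ℓ) A.mem 0) hq
  refine (Finset.sum_le_sum fun t _ => A.surrogate_sub_surrogate_le q t).trans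
    ((A.newtonIterates.regret_le hq T).trans ?_)
  calc _ ≤ cfg.lam / (2 * (1 / α)) * (4 * (du * dy * cfg.R ^ 2)) +
        1 / α * gradientBound L Rnat cK ρK cfg.R ^ 2 / 2 *
          ∑ t ∈ Finset.range T, lev P K cfg t := by gcongr
    _ = _ := by field_simp; ring

lemma sum_lev_le (A : TunedRun P K ℓ cfg z₁ L α Rnat cK ρK) (T : ℕ) :
    ∑ t ∈ Finset.range T, lev P K cfg t ≤ cfg.m * (du * dy) * Real.log (1 + T) := by
  have trace_le (t : ℕ) : ((algH P K cfg t)ᵀ * algH P K cfg t).trace ≤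
      cfg.lam * Fintype.card (Fin cfg.m × Fin du × Fin dy) :=
    (trace_featH_le A.cK_pos.le A.ρK_pos.le A.ρK_lt_one A.markov_le A.l2norm_natY_le t).trans
      (mul_le_mul_of_nonneg_right A.le_lam (Nat.cast_nonneg _))
  simpa only [Fintype.card_prod, Fintype.card_fin, Nat.cast_mul] using
    sum_roundLeverage_le A.lam_pos trace_le T

theorem regret_le (A : TunedRun P K ℓ cfg z₁ L α Rnat cK ρK) {cs ρs : ℝ} (hcs : 1 ≤ cs)
    (hρs : 0 ≤ ρs) (hρs1 : ρs < 1) {π : LDC du dy} (hπ : π ∈ stabClass P K cs ρs)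
    (hR : cfg.R = (1 + opNorm K) * cs / (1 - ρs)) (T : ℕ) :
    ∑ t ∈ Finset.range T, ℓ t (algIterate P K ℓ cfg z₁ t) -
        ∑ t ∈ Finset.range T, ℓ t (ldcIterate P π t) ≤
      T * (gradientBound L Rnat cK ρK cfg.R * (deviationBound Rnat cK ρK cfg.R *
        (ρs ^ cfg.m + 2 * ρK ^ cfg.h))) +
      2 * α * cfg.lam * (du * dy * cfg.R ^ 2) +
      gradientBound L Rnat cK ρK cfg.R ^ 2 / α * (1 / 2 + (1 + opNorm K) * cK / (1 - ρK) ^ 2) *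
        (cfg.m * (du * dy) * Real.log (1 + T)) := by
  have q_mem := ofMarkov_responseMat_mem_drcSet (m := cfg.m) hcs hρs hρs1 hπ
  rw [← hR] at q_mem
  set q := Param.ofMarkov cfg.m (responseMat P K π)
  have memory_cost := A.sum_loss_sub_surrogate_le T
  have newton_regret := A.sum_surrogate_sub_le q_mem T
  have comparator_error :=
    A.sum_surrogate_sub_ldcIterate_le A.lossRegular A.α_pos.le hcs hρs hρs1 hπ hR T
  rw [Finset.sum_sub_distrib] at memory_cost newton_regret comparator_error
  set γ := gradientBound L Rnat cK ρK cfg.R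
  set D := deviationBound Rnat cK ρK cfg.R
  have leverage_coeff_nonneg : 0 ≤ γ ^ 2 / α * (1 / 2 + (1 + opNorm K) * cK / (1 - ρK) ^ 2) := by
    have := A.α_pos
    have := A.cK_pos
    have := opNorm_nonneg K
    positivity
  have leverage_cost := mul_le_mul_of_nonneg_left (A.sum_lev_le T) leverage_coeff_nonneg
  have split_coeff : γ ^ 2 / α * (1 / 2 + (1 + opNorm K) * cK / (1 - ρK) ^ 2) =
      γ ^ 2 / α * ((1 + opNorm K) * cK / (1 - ρK) ^ 2) + γ ^ 2 / (2 * α) := by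
    rw [mul_comm 2 α, ← div_div]
    ring
  rw [split_coeff] at leverage_cost ⊢
  linarith

end TunedRun

end Regret

/-! ### The prescribed tuning -/

section ErrorTerms

variable {a b n v w D L α γ h m l : ℝ}

lemma truncation_error_le {p q τ : ℝ} (hγD : γ ≤ 2 * (L * D)) (hL : 0 ≤ L) (hD : 0 ≤ D)
    (hp0 : 0 ≤ p) (hq0 : 0 ≤ q) (hτ : 0 < τ) (hp : p ≤ 1 / τ) (hq : q ≤ 1 / τ) :
    τ * (γ * (D * (p + 2 * q))) ≤ 6 * (L * D ^ 2) := by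
  calc τ * (γ * (D * (p + 2 * q))) ≤ τ * (2 * (L * D) * (D * (1 / τ + 2 * (1 / τ)))) := by gcongr
    _ = 6 * (L * D ^ 2) := by field_simp; ring

lemma le_sq_div_of_le (hα : 0 < α) (hL : α ≤ L) : L ≤ L ^ 2 / α := by
  rw [le_div_iff₀ hα, sq]
  exact mul_le_mul_of_nonneg_left hL (hα.trans_le hL).le

lemma approximation_term_le (hα : 0 < α) (hL : α ≤ L) (hn : 1 ≤ n) (hw : 1 ≤ w) :
    L * D ^ 2 ≤ L ^ 2 / α * D ^ 2 * n * w := by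
  calc L * D ^ 2 ≤ L ^ 2 / α * D ^ 2 :=
        mul_le_mul_of_nonneg_right (le_sq_div_of_le hα hL) (sq_nonneg D)
    _ ≤ L ^ 2 / α * D ^ 2 * (n * w) :=
        le_mul_of_one_le_right (by positivity) (one_le_mul_of_one_le_of_one_le hn hw)
    _ = _ := (mul_assoc _ _ _).symm

lemma regularization_term_le (hα : 0 < α) (hL : α ≤ L) (hn : 0 ≤ n) (hh : h ≤ 2 * l * a)
    (hw : l * a ≤ w) (hw0 : 0 ≤ w) :
    α * h * n * D ^ 2 ≤ 2 * (L ^ 2 / α * D ^ 2 * n * w) := by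
  have h_le : h ≤ 2 * w := by linarith
  calc α * h * n * D ^ 2 ≤ α * (2 * w) * n * D ^ 2 := by gcongr
    _ ≤ L ^ 2 / α * (2 * w) * n * D ^ 2 := by gcongr; exact hL.trans (le_sq_div_of_le hα hL)
    _ = _ := by ring

lemma leverage_term_le (hα : 0 < α) (hγ : 0 ≤ γ) (hγD : γ ≤ 2 * (L * D)) (hn : 0 ≤ n) (hl : 0 ≤ l)
    (hv : 1 ≤ v) (hm0 : 0 ≤ m) (hm : m ≤ 2 * l * b) (hw : v * (l ^ 2 * b) ≤ w) :
    γ ^ 2 / α * (1 / 2 + v) * (m * n * l) ≤ 12 * (L ^ 2 / α * D ^ 2 * n * w) := by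
  have half_add_le : 1 / 2 + v ≤ 3 / 2 * v := by linarith
  calc γ ^ 2 / α * (1 / 2 + v) * (m * n * l)
      ≤ (2 * (L * D)) ^ 2 / α * (3 / 2 * v) * (2 * l * b * n * l) := by gcongr
    _ = 12 * (L ^ 2 / α * D ^ 2 * n * (v * (l ^ 2 * b))) := by ring
    _ ≤ 12 * (L ^ 2 / α * D ^ 2 * n * w) := by gcongr

lemma error_terms_le (hα : 0 < α) (hL : α ≤ L) (hγ : 0 ≤ γ) (hγD : γ ≤ 2 * (L * D)) (hn : 1 ≤ n)
    (ha : 1 ≤ a) (hb : 1 ≤ b) (hl : 1 ≤ l) (hv : 1 ≤ v) (hh : h ≤ 2 * l * a) (hm0 : 0 ≤ m)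
    (hm : m ≤ 2 * l * b) :
    6 * (L * D ^ 2) + 12 * (α * h * n * D ^ 2) + γ ^ 2 / α * (1 / 2 + v) * (m * n * l) ≤
      42 * (L ^ 2 / α * D ^ 2 * n * (v * a * b * l ^ 4)) := by
  have one_le_la := one_le_mul_of_one_le_of_one_le hl ha
  have la_le : l * a ≤ v * a * b * l ^ 4 := by
    calc l * a ≤ l * a * (v * b * l ^ 3) :=
          le_mul_of_one_le_right (zero_le_one.trans one_le_la) (one_le_mul_of_one_le_of_one_le
            (one_le_mul_of_one_le_of_one_le hv hb) (one_le_pow₀ hl))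
      _ = _ := by ring
  have vlb_le : v * (l ^ 2 * b) ≤ v * a * b * l ^ 4 := by
    calc v * (l ^ 2 * b) ≤ v * (l ^ 2 * b) * (a * l ^ 2) :=
          le_mul_of_one_le_right (by positivity)
            (one_le_mul_of_one_le_of_one_le ha (one_le_pow₀ hl))
      _ = _ := by ring
  have approximation := approximation_term_le (D := D) hα hL hn (one_le_la.trans la_le)
  have regularization := regularization_term_le (D := D) hα hL (zero_le_one.trans hn) hh la_le
    (zero_le_one.trans (one_le_la.trans la_le))
  have leverage := leverage_term_le hα hγ hγD (zero_le_one.trans hn) (zero_le_one.trans hl) hv hm0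
    hm vlb_le
  linarith

end ErrorTerms

section Tuning

lemma controlRegret_le {dx du dy : ℕ} {P : Plant dx du dy} {ℓ : ℕ → Sig dy du → ℝ} {T : ℕ}
    {v : ℕ → Sig dy du} {cls : Set (LDC du dy)} {c : ℝ}
    (h : ∀ π ∈ cls, ∑ t ∈ Finset.range T, ℓ t (v t) -
      ∑ t ∈ Finset.range T, ℓ t (ldcIterate P π t) ≤ c) :
    controlRegret P ℓ T v cls ≤ (c : EReal) := by
  have le_infimum : (((∑ t ∈ Finset.range T, ℓ t (v t)) - c : ℝ) : EReal) ≤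
      ⨅ π ∈ cls, ((∑ t ∈ Finset.range T, ℓ t (ldcIterate P π t) : ℝ) : EReal) :=
    le_iInf₂ fun π hπ => EReal.coe_le_coe_iff.2 (sub_le_comm.1 (h π hπ))
  refine (EReal.sub_le_sub le_rfl le_infimum).trans_eq ?_
  rw [← EReal.coe_sub, sub_sub_cancel]

variable {dx du dy : ℕ} {P : Plant dx du dy} {K : Matrix (Fin du) (Fin dy) ℝ}
  {ℓ : ℕ → Sig dy du → ℝ} {L α Rnat cK ρK cs ρs : ℝ}

lemma IsDriven.iterate_eq_natIterate {x : ℕ → Vec dx} {u : ℕ → Vec du} (hx : IsDriven P K x u)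
    {t : ℕ} (hu : ∀ s ≤ t, u s = 0) : drivenIterate P K x u t = natIterate P K t := by
  have conv_eq_zero : conv (markovK P K) u t = 0 :=
    Finset.sum_eq_zero fun i _ => by rw [hu _ (Nat.sub_le t i), mulVec_zero]
  rw [hx.iterate_eq, conv_eq_zero, WithLp.toLp_zero, add_zero]

lemma algIterate_eq_natIterate_of_isEmpty {cfg : Config} [IsEmpty (Fin cfg.m × Fin du × Fin dy)]
    (z₁ : Param cfg.m du dy) (t : ℕ) : algIterate P K ℓ cfg z₁ t = natIterate P K t := by
  rw [algIterate_eq_drivenIterate]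
  refine (isDriven_algX P K ℓ cfg z₁).iterate_eq_natIterate fun s _ => ?_
  rw [algEx_eq]
  exact funext fun _ => Finset.sum_of_isEmpty _

lemma ldcIterate_eq_natIterate_of_isEmpty [IsEmpty (Fin du × Fin dy)] (π : LDC du dy) (t : ℕ) :
    ldcIterate P π t = natIterate P K t := by
  rw [ldcIterate_eq_drivenIterate P K]
  refine (isDriven_ldcX P K π).iterate_eq_natIterate fun s _ => ?_
  have mulVec_eq_zero (M : Matrix (Fin du) (Fin dy) ℝ) (y : Vec dy) : M *ᵥ y = 0 :=
    funext fun a => show ∑ b, M a b * y b = 0 from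
      Finset.sum_eq_zero fun b _ => isEmptyElim (a, b)
  rw [ldcEx_eq_conv]
  exact Finset.sum_eq_zero fun i _ => mulVec_eq_zero _ _

namespace StableNominal

lemma one_le_cK (A : StableNominal P K Rnat cK ρK) (hdu : 0 < du) : 1 ≤ cK := by
  simpa [markovK] using
    (abs_entry_le_opNorm (markovK P K 0) (Sum.inr ⟨0, hdu⟩) ⟨0, hdu⟩).trans (A.markov_le 0)

lemma one_le_cK_div (A : StableNominal P K Rnat cK ρK) (hcK : 1 ≤ cK) : 1 ≤ cK / (1 - ρK) :=
  (one_le_div A.one_sub_ρK_pos).2 ((sub_le_self 1 A.ρK_pos.le).trans hcK)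

lemma one_le_memoryFactor (A : StableNominal P K Rnat cK ρK) (hcK : 1 ≤ cK) :
    1 ≤ (1 + opNorm K) * cK / (1 - ρK) ^ 2 := by
  rw [one_le_div (pow_pos A.one_sub_ρK_pos 2)]
  exact (pow_le_one₀ A.one_sub_ρK_pos.le (sub_le_self 1 A.ρK_pos.le)).trans
    (one_le_mul_of_one_le_of_one_le (le_add_of_nonneg_right (opNorm_nonneg K)) hcK)

lemma gradientBound_le (A : StableNominal P K Rnat cK ρK) (hL : 0 ≤ L) (hcK : 1 ≤ cK) {R : ℝ}
    (hR : 1 ≤ R) : gradientBound L Rnat cK ρK R ≤ 2 * (L * deviationBound Rnat cK ρK R) := by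
  have Rnat_le : Rnat ≤ deviationBound Rnat cK ρK R :=
    (le_mul_of_one_le_left A.Rnat_nonneg hR).trans
      (le_mul_of_one_le_left (mul_nonneg (zero_le_one.trans hR) A.Rnat_nonneg)
        (A.one_le_cK_div hcK))
  rw [gradientBound, mul_left_comm, two_mul]
  gcongr

end StableNominal

lemma one_le_explicitConfig_R {T : ℕ} (hcs : 1 ≤ cs) (hρs : 0 ≤ ρs) (hρs1 : ρs < 1) :
    1 ≤ (explicitConfig T K α Rnat cK ρK cs ρs).R :=
  one_le_mul_of_one_le_of_one_le (le_add_of_nonneg_right (opNorm_nonneg K))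
    ((one_le_div (sub_pos.2 hρs1)).2 ((sub_le_self 1 hρs).trans hcs))

lemma two_mul_α_mul_lam_eq {T : ℕ} {n : ℝ} :
    2 * α * (explicitConfig T K α Rnat cK ρK cs ρs).lam *
        (n * (explicitConfig T K α Rnat cK ρK cs ρs).R ^ 2) =
      12 * (α * (explicitConfig T K α Rnat cK ρK cs ρs).h * n *
        deviationBound Rnat cK ρK (explicitConfig T K α Rnat cK ρK cs ρs).R ^ 2) := by
  rw [deviationBound, explicitConfig]
  ring

lemma StableNominal.tunedRun (A : StableNominal P K Rnat cK ρK) (hα : 0 < α)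
    (hℓ : ∀ t, LossRegular L α (ℓ t)) {T : ℕ} (hT : 2 ≤ T)
    {z₁ : Param (explicitConfig T K α Rnat cK ρK cs ρs).m du dy}
    (hz₁ : z₁ ∈ drcSet (explicitConfig T K α Rnat cK ρK cs ρs).m du dy
      (explicitConfig T K α Rnat cK ρK cs ρs).R) :
    TunedRun P K ℓ (explicitConfig T K α Rnat cK ρK cs ρs) z₁ L α Rnat cK ρK where
  toStableNominal := A
  lossRegular := hℓ
  α_pos := hα
  η_eq := rfl
  mem := hz₁
  le_lam := by
    have h_pos : (1 : ℝ) ≤ ⌈Real.log T / (1 - ρK)⌉₊ := Nat.one_le_cast.2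
      (ceil_log_div_one_sub_pos A.ρK_lt_one (Nat.one_lt_cast.2 hT))
    calc (cK / (1 - ρK) * Rnat) ^ 2 ≤ 6 * ⌈Real.log T / (1 - ρK)⌉₊ * (cK / (1 - ρK) * Rnat) ^ 2 :=
          le_mul_of_one_le_left (sq_nonneg _) (by linarith)
      _ = _ := by rw [explicitConfig]; ring

/-- The regret rate of DRC-ONS, up to a universal constant. -/
def regretRate (K : Matrix (Fin du) (Fin dy) ℝ) (L α Rnat cK ρK cs ρs : ℝ) (T : ℕ) : ℝ :=
  cK ^ 3 * cs ^ 2 * (1 + opNorm K) ^ 3 / ((1 - ρK) ^ 5 * (1 - ρs) ^ 3) *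
    ((du : ℝ) * (dy : ℝ) * Rnat ^ 2) * (L ^ 2 / α) * Real.log (1 + (T : ℝ)) ^ 4

lemma regretRate_nonneg (hα : 0 ≤ α) (hcK : 0 ≤ cK) (hρK : ρK ≤ 1) (hρs : ρs ≤ 1) (T : ℕ) :
    0 ≤ regretRate K L α Rnat cK ρK cs ρs T := by
  have : 0 ≤ Real.log (1 + (T : ℝ)) :=
    Real.log_nonneg (le_add_of_nonneg_right (Nat.cast_nonneg T))
  have := sub_nonneg.2 hρK
  have := sub_nonneg.2 hρs
  have := opNorm_nonneg K
  rw [regretRate]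
  positivity

lemma regretRate_eq {ρK ρs : ℝ} (hρK1 : ρK < 1) (hρs1 : ρs < 1) (T : ℕ) :
    regretRate K L α Rnat cK ρK cs ρs T =
      L ^ 2 / α * deviationBound Rnat cK ρK ((1 + opNorm K) * (cs / (1 - ρs))) ^ 2 * (du * dy) *
        ((1 + opNorm K) * cK / (1 - ρK) ^ 2 * (1 / (1 - ρK)) * (1 / (1 - ρs)) *
          Real.log (1 + T) ^ 4) := by
  have one_sub_ρK_ne := (sub_pos.2 hρK1).ne'
  have one_sub_ρs_ne := (sub_pos.2 hρs1).ne'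
  rw [regretRate, deviationBound]
  field_simp

lemma initial_loss_le_regretRate (hα : 0 < α) (hL : α ≤ L) (hdu : 0 < du) (hdy : 0 < dy)
    (hcK : 1 ≤ cK) (hρK : 0 ≤ ρK) (hρK1 : ρK < 1) (hcs : 1 ≤ cs) (hρs : 0 ≤ ρs) (hρs1 : ρs < 1) :
    L * Rnat ^ 2 ≤ 42 * regretRate K L α Rnat cK ρK cs ρs 1 := by
  have one_le_factor : 1 ≤ cK ^ 3 * cs ^ 2 * (1 + opNorm K) ^ 3 /
      ((1 - ρK) ^ 5 * (1 - ρs) ^ 3) := by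
    have one_sub_ρK_pos := sub_pos.2 hρK1
    have one_sub_ρs_pos := sub_pos.2 hρs1
    have denominator_le_one : (1 - ρK) ^ 5 * (1 - ρs) ^ 3 ≤ 1 :=
      mul_le_one₀ (pow_le_one₀ one_sub_ρK_pos.le (sub_le_self 1 hρK)) (by positivity)
        (pow_le_one₀ one_sub_ρs_pos.le (sub_le_self 1 hρs))
    rw [one_le_div (by positivity)]
    exact denominator_le_one.trans (one_le_mul_of_one_le_of_one_le (one_le_mul_of_one_le_of_one_le
      (one_le_pow₀ hcK) (one_le_pow₀ hcs))
      (one_le_pow₀ (le_add_of_nonneg_right (opNorm_nonneg K))))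
  have one_le_dim : (1 : ℝ) ≤ du * dy := by exact_mod_cast Nat.mul_pos hdu hdy
  have one_le_log : 1 ≤ 42 * Real.log (1 + (1 : ℕ)) ^ 4 := by
    have := pow_le_pow_left₀ (by norm_num) Real.log_two_gt_d9.le 4
    norm_num at this ⊢
    linarith
  calc L * Rnat ^ 2 ≤ L ^ 2 / α * Rnat ^ 2 :=
        mul_le_mul_of_nonneg_right (le_sq_div_of_le hα hL) (sq_nonneg Rnat)
    _ ≤ L ^ 2 / α * Rnat ^ 2 * (cK ^ 3 * cs ^ 2 * (1 + opNorm K) ^ 3 /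
          ((1 - ρK) ^ 5 * (1 - ρs) ^ 3) * (du * dy) * (42 * Real.log (1 + (1 : ℕ)) ^ 4)) :=
        le_mul_of_one_le_right (by positivity) (one_le_mul_of_one_le_of_one_le
          (one_le_mul_of_one_le_of_one_le one_le_factor one_le_dim) one_le_log)
    _ = _ := by rw [regretRate]; ring

namespace StableNominal

variable {T : ℕ} {z₁ : Param (explicitConfig T K α Rnat cK ρK cs ρs).m du dy} {π : LDC du dy}

lemma regret_le_of_two_le (A : StableNominal P K Rnat cK ρK) (hα : 0 < α)
    (hℓ : ∀ t, LossRegular L α (ℓ t)) (hL : α ≤ L) (hdu : 0 < du) (hdy : 0 < dy) (hT : 2 ≤ T)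
    (hcs : 1 ≤ cs) (hρs : 0 < ρs) (hρs1 : ρs < 1)
    (hz₁ : z₁ ∈ drcSet (explicitConfig T K α Rnat cK ρK cs ρs).m du dy
      (explicitConfig T K α Rnat cK ρK cs ρs).R) (hπ : π ∈ stabClass P K cs ρs) :
    ∑ t ∈ Finset.range T,
        ℓ t (algIterate P K ℓ (explicitConfig T K α Rnat cK ρK cs ρs) z₁ t) -
      ∑ t ∈ Finset.range T, ℓ t (ldcIterate P π t) ≤
      42 * regretRate K L α Rnat cK ρK cs ρs T := by
  have run := A.tunedRun hα hℓ hT hz₁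
  have regret_le := run.regret_le hcs hρs.le hρs1 hπ (mul_div_assoc _ _ _).symm T
  have hcK := A.one_le_cK hdu
  have γ_le := A.gradientBound_le (hα.trans_le hL).le hcK
    (one_le_explicitConfig_R (K := K) (α := α) (Rnat := Rnat) (cK := cK) (ρK := ρK) (T := T)
      hcs hρs.le hρs1)
  have γ_nonneg := run.gradientBound_nonneg
  have T_pos : 0 < T := zero_lt_two.trans_le hT
  have two_le_T : (2 : ℝ) ≤ T := Nat.ofNat_le_cast.2 hT
  have one_le_dim : (1 : ℝ) ≤ du * dy := by exact_mod_cast Nat.mul_pos hdu hdy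
  have one_le_log := one_le_log_one_add two_le_T
  have h_le : ((explicitConfig T K α Rnat cK ρK cs ρs).h : ℝ) ≤ _ :=
    ceil_log_div_one_sub_le A.ρK_pos.le A.ρK_lt_one two_le_T
  have m_le : ((explicitConfig T K α Rnat cK ρK cs ρs).m : ℝ) ≤ _ :=
    ceil_log_div_one_sub_le hρs.le hρs1 two_le_T
  have h_pow_le : ρK ^ (explicitConfig T K α Rnat cK ρK cs ρs).h ≤ 1 / T :=
    pow_ceil_log_le A.ρK_pos A.ρK_lt_one T_pos
  have m_pow_le : ρs ^ (explicitConfig T K α Rnat cK ρK cs ρs).m ≤ 1 / T :=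
    pow_ceil_log_le hρs hρs1 T_pos
  have truncation_le := truncation_error_le γ_le (hα.trans_le hL).le
    (A.deviationBound_nonneg run.R_nonneg) (pow_nonneg hρs.le _) (pow_nonneg A.ρK_pos.le _)
    (Nat.cast_pos.2 T_pos) m_pow_le h_pow_le
  have error_le := error_terms_le hα hL γ_nonneg γ_le one_le_dim
    (one_le_one_div A.one_sub_ρK_pos (sub_le_self 1 A.ρK_pos.le))
    (one_le_one_div (sub_pos.2 hρs1) (sub_le_self 1 hρs.le)) one_le_log
    (A.one_le_memoryFactor hcK) h_le (Nat.cast_nonneg _) m_le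
  rw [two_mul_α_mul_lam_eq] at regret_le
  rw [regretRate_eq A.ρK_lt_one hρs1]
  exact regret_le.trans ((add_le_add_left (add_le_add_left truncation_le _) _).trans error_le)

theorem regret_le (A : StableNominal P K Rnat cK ρK) (hα : 0 < α)
    (hℓ : ∀ t, LossRegular L α (ℓ t)) (hcs : 1 ≤ cs) (hρs : 0 < ρs) (hρs1 : ρs < 1)
    (hz₁ : z₁ ∈ drcSet (explicitConfig T K α Rnat cK ρK cs ρs).m du dy
      (explicitConfig T K α Rnat cK ρK cs ρs).R) (hπ : π ∈ stabClass P K cs ρs) :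
    ∑ t ∈ Finset.range T,
        ℓ t (algIterate P K ℓ (explicitConfig T K α Rnat cK ρK cs ρs) z₁ t) -
      ∑ t ∈ Finset.range T, ℓ t (ldcIterate P π t) ≤
      42 * regretRate K L α Rnat cK ρK cs ρs T := by
  have rate_nonneg : 0 ≤ regretRate K L α Rnat cK ρK cs ρs T :=
    regretRate_nonneg hα.le A.cK_pos.le A.ρK_lt_one.le hρs1.le T
  rcases isEmpty_or_nonempty (Fin du × Fin dy) with no_entries | ⟨⟨⟨_, hdu⟩, ⟨_, hdy⟩⟩⟩
  · rw [Finset.sum_congr rfl fun t _ => by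
      rw [algIterate_eq_natIterate_of_isEmpty, ← ldcIterate_eq_natIterate_of_isEmpty π], sub_self]
    positivity
  replace hdu := Nat.zero_lt_of_lt hdu
  replace hdy := Nat.zero_lt_of_lt hdy
  have hL : α ≤ L :=
    (hℓ 0).convexity_le_const (v := EuclideanSpace.single (Sum.inr ⟨0, hdu⟩) 1) (by simp)
  match T with
  | 0 => simpa only [Finset.sum_range_zero, sub_zero] using mul_nonneg (by norm_num) rate_nonneg
  | 1 =>
    have m_eq_zero : (explicitConfig 1 K α Rnat cK ρK cs ρs).m = 0 := by simp [explicitConfig]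
    have : IsEmpty (Fin (explicitConfig 1 K α Rnat cK ρK cs ρs).m) := by
      rw [m_eq_zero]; infer_instance
    rw [Finset.sum_range_one, Finset.sum_range_one, algIterate_eq_natIterate_of_isEmpty]
    calc ℓ 0 (natIterate P K 0) - ℓ 0 (ldcIterate P π 0)
        ≤ ℓ 0 (natIterate P K 0) := sub_le_self _ ((hℓ 0).nonneg _)
      _ ≤ L * Rnat ^ 2 := ((hℓ 0).le _).trans (mul_le_mul_of_nonneg_left
          (max_le (one_le_pow₀ A.one_le_Rnat) (pow_le_pow_left₀ (norm_nonneg _) (A.nat_le 0) 2))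
          (hℓ 0).const_nonneg)
      _ ≤ _ := initial_loss_le_regretRate hα hL hdu hdy (A.one_le_cK hdu) A.ρK_pos.le A.ρK_lt_one
          hcs hρs.le hρs1
  | T + 2 =>
    exact A.regret_le_of_two_le hα hℓ hL hdu hdy (Nat.le_add_left 2 T) hcs hρs hρs1 hz₁ hπ

end StableNominal

end Tuning

end DrcOns

end

theorem mainTheorem3 :
    ∃ Cst : ℝ, 0 < Cst ∧
      ∀ (dx du dy T : ℕ) (P : DrcOns.Plant dx du dy) (K : Matrix (Fin du) (Fin dy) ℝ)
        (ℓ : ℕ → DrcOns.Sig dy du → ℝ) (L α Rnat cK ρK cs ρs : ℝ),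
        0 < α →
        (∀ t, DrcOns.LossRegular L α (ℓ t)) →
        1 ≤ Rnat →
        (∀ t, ‖DrcOns.natIterate P K t‖ ≤ Rnat) →
        0 < cK → 0 < ρK → ρK < 1 →
        (∀ n : ℕ, DrcOns.opNorm (DrcOns.markovK P K n) ≤ cK * ρK ^ n) →
        1 ≤ cs → 0 < ρs → ρs < 1 →
        ∀ z₁ ∈ DrcOns.drcSet (DrcOns.explicitConfig T K α Rnat cK ρK cs ρs).m du dy
            (DrcOns.explicitConfig T K α Rnat cK ρK cs ρs).R,
          DrcOns.controlRegret P ℓ T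
              (DrcOns.algIterate P K ℓ (DrcOns.explicitConfig T K α Rnat cK ρK cs ρs) z₁)
              (DrcOns.stabClass P K cs ρs) ≤
            ((Cst *
              (cK ^ 3 * cs ^ 2 * (1 + DrcOns.opNorm K) ^ 3 / ((1 - ρK) ^ 5 * (1 - ρs) ^ 3) *
                ((du : ℝ) * (dy : ℝ) * Rnat ^ 2) * (L ^ 2 / α) *
                Real.log (1 + (T : ℝ)) ^ 4) : ℝ) : EReal) := by
  refine ⟨42, by norm_num, ?_⟩
  intro dx du dy T P K ℓ L α Rnat cK ρK cs ρs hα hℓ hRn hnat hcK hρK hρK1 hG hcs hρs hρs1 z₁ hz₁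
  exact DrcOns.controlRegret_le fun π hπ =>
    DrcOns.StableNominal.regret_le ⟨hRn, hnat, hcK, hρK, hρK1, hG⟩ hα hℓ hcs hρs hρs1 hz₁ hπ
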